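/- Let $d\ge 1$, write $\hat z=(z_1,\dots,z_{d-1})$, and let $p\in\mathbb C[z_1,\dots,z_d]$ be irreducible, without zeros in the polydisk $\mathbb D^d$, of polydegree $(n,1)=(n_1,\dots,n_{d-1},1)$ (that is, $\deg_{z_j}p=n_j$ for $j<d$ and $\deg_{z_d}p=1$), sharing no nonconstant factor with its reflection $\tilde p(z)=z_1^{n_1}\cdots z_{d-1}^{n_{d-1}}z_d\,\overline{p(1/\bar z_1,\dots,1/\bar z_d)}$, and with only finitely many zeros on the torus $\mathbb T^d$. Let $\phi=\tilde p/p$ be the corresponding finite-singularity rational inner function, and assume that it has a singularity at $\vec 1=(1,\dots,1)$, i.e. $p(\vec 1)=0$. The local $z_d$-derivative integrability index at $\vec 1$ of a rational function $f$ on $\mathbb D^d$ (extended rationally to almost every point of $\mathbb T^d$) is the supremum, assumed finite, of all $\mathfrak p\ge 1$ such that $\partial f/\partial z_d\in L^{\mathfrak p}(U)$ for some neighbourhood $U$ of $\vec 1$ in $\mathbb T^d$. For $N\ge1$ let $\phi^N(\hat z,z_d)=(\phi_{\hat z}\circ\cdots\circ\phi_{\hat z})(z_d)$ ($N$ factors),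 where $\phi_{\hat z}(w)=\phi(\hat z,w)$. Write $p=p_1(\hat z)+z_d\,p_2(\hat z)$ and $\tilde p=\tilde p_2(\hat z)+z_d\,\tilde p_1(\hat z)$, and let $M_\phi=\begin{pmatrix}\tilde p_1&\tilde p_2\\ p_2&p_1\end{pmatrix}$ be the slice matrix of $\phi$. **Theorem.** Suppose that the local $z_d$-derivative integrability index of $\phi$ at $\vec 1$ is $1+\mathfrak q^*$ with $\mathfrak q^*\ge0$. Let $N\ge1$ and suppose that $\phi^N$ has full polydegree: written in lowest terms, the rational function $\phi^N$ has polydegree $(Nn_1,\dots,Nn_{d-1},1)$, where the degree in $z_j$ is the larger of those of numerator and denominator. If $d\ge3$, suppose also that $M_\phi(1,\dots,1)^N\ne0$. Then $\phi^N=\tilde p_N/p_N$ on $\mathbb D^d$ for a polynomial $p_N$ with no zeros in $\mathbb D^d$ and of degree at most $Nn_j$ in $z_j$ ($j<d$) and at most $1$ in $z_d$, which shares no nonconstant factor with its reflection $\tilde p_N$ with respect to the polydegree $(Nn_1,\dots,Nn_{d-1},1)$ and satisfies $p_N(\vec 1)=0$ (so $\phi^N$ is a rational inner function with a singularity at $\vec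 1$). Moreover $\phi^N$ has local $z_d$-derivative integrability index $1+\mathfrak q^*/N$ at $\vec 1$. -/

import Mathlib

open MeasureTheory Filter Topology ComplexConjugate

noncomputable section

namespace RIF

/-- The open unit polydisk in `ℂ^d`. -/
def polydisk (d : ℕ) : Set (Fin d → ℂ) := {z | ∀ j, ‖z j‖ < 1}

/-- The `d`-torus in `ℂ^d` (the distinguished boundary of the polydisk). -/
def torus (d : ℕ) : Set (Fin d → ℂ) := {z | ∀ j, ‖z j‖ = 1}

/-- The reflection of a polynomial `p` with respect to the polydegree `k`,
`z ↦ z^k * conj (p (1 / conj z))`: each term `c z^α` becomes `conj c * z^(k - α)`.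
It is used only when `p` has degree at most `k j` in each variable `z j`. -/
def reflect {d : ℕ} (k : Fin d → ℕ) (p : MvPolynomial (Fin d) ℂ) : MvPolynomial (Fin d) ℂ :=
  ∑ α ∈ p.support,
    MvPolynomial.monomial (Finsupp.equivFunOnFinite.symm k - α) (conj (p.coeff α))

/-- The reflection is given by the usual formula `z^k * conj (p (1 / conj z))`. -/
theorem eval_reflect {d : ℕ} (k : Fin d → ℕ) (p : MvPolynomial (Fin d) ℂ)
    (hk : ∀ j, p.degreeOf j ≤ k j) (z : Fin d → ℂ) (hz : ∀ j, z j ≠ 0) :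
    MvPolynomial.eval z (reflect k p) =
      (∏ j, z j ^ k j) * conj (MvPolynomial.eval (fun j => 1 / conj (z j)) p) := by
  rw [MvPolynomial.eval_eq' (fun j => 1 / conj (z j)) p, map_sum, Finset.mul_sum, reflect, map_sum]
  refine Finset.sum_congr rfl fun α hα => ?_
  rw [MvPolynomial.eval_monomial, Finsupp.prod_fintype _ _ (by simp), map_mul, map_prod,
    mul_left_comm, ← Finset.prod_mul_distrib]
  congr 1
  refine Finset.prod_congr rfl fun j _ => ?_
  have h : α j ≤ k j := le_trans (MvPolynomial.monomial_le_degreeOf j hα) (hk j)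
  simp only [Finsupp.coe_tsub, Pi.sub_apply, Finsupp.equivFunOnFinite_symm_apply_apply]
  rw [pow_sub₀ _ (hz j) h]
  simp

/-- `p` has no zeros in the open polydisk. -/
def IsStable {d : ℕ} (p : MvPolynomial (Fin d) ℂ) : Prop :=
  ∀ z ∈ polydisk d, MvPolynomial.eval z p ≠ 0

/-- The polydegree `(n, 1)`. -/
def polydeg {m : ℕ} (n : Fin m → ℕ) : Fin (m + 1) → ℕ :=
  Fin.snoc (α := fun _ => ℕ) n 1

/-- The rational function `p̃ / p`, where `p̃` is the reflection with respect to `k`. -/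
def quot {d : ℕ} (k : Fin d → ℕ) (p : MvPolynomial (Fin d) ℂ) (z : Fin d → ℂ) : ℂ :=
  MvPolynomial.eval z (reflect k p) / MvPolynomial.eval z p

/-- `p` is the denominator of a finite-singularity rational inner function `p̃ / p` of polydegree
`(n, 1)` in `d = m + 1` variables: `p` is irreducible, stable, has polydegree `(n, 1)`, shares no
factor with its reflection, and has finitely many zeros on the torus. -/
structure IsFiniteSingularity {m : ℕ} (n : Fin m → ℕ) (p : MvPolynomial (Fin (m + 1)) ℂ) :
    Prop where
  irreducible : Irreducible p
  stable : IsStable p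
  degree : ∀ j, p.degreeOf j = polydeg n j
  atoral : IsRelPrime p (reflect (polydeg n) p)
  finite : {ζ ∈ torus (m + 1) | MvPolynomial.eval ζ p = 0}.Finite

/-- The `N`-fold composition of `f` in its last variable, the other variables being frozen:
`z ↦ (f_ẑ ∘ ⋯ ∘ f_ẑ) (z_d)` with `f_ẑ w = f (ẑ, w)`. -/
def sliceIter {m : ℕ} (f : (Fin (m + 1) → ℂ) → ℂ) (N : ℕ) (z : Fin (m + 1) → ℂ) : ℂ :=
  (fun w : ℂ => f (Function.update z (Fin.last m) w))^[N] (z (Fin.last m))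

/-- The function `f` on the polydisk is rational and, in lowest terms `q / r`, has
polydegree `k`: for each `j`, the larger of the degrees of `q` and `r` in `z_j` is `k j`. -/
def HasPolydegree {d : ℕ} (f : (Fin d → ℂ) → ℂ) (k : Fin d → ℕ) : Prop :=
  ∃ q r : MvPolynomial (Fin d) ℂ, IsRelPrime q r ∧
    (∀ z ∈ polydisk d, MvPolynomial.eval z r ≠ 0 ∧
      f z = MvPolynomial.eval z q / MvPolynomial.eval z r) ∧
    ∀ j, max (q.degreeOf j) (r.degreeOf j) = k j

/-- The slice matrix `M(ẑ) = (p̃₁ p̃₂; p₂ p₁)`, where `p = p₁ + z_d p₂` and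
`p̃ = p̃₂ + z_d p̃₁` have degree at most one in the last variable: the constant term is the value
at `z_d = 0` and the coefficient of `z_d` is the partial derivative in `z_d`. -/
def sliceMatrix {m : ℕ} (n : Fin m → ℕ) (p : MvPolynomial (Fin (m + 1)) ℂ) (z : Fin m → ℂ) :
    Matrix (Fin 2) (Fin 2) ℂ :=
  let z₀ : Fin (m + 1) → ℂ := Fin.snoc (α := fun _ => ℂ) z 0
  let pt := reflect (polydeg n) p
  !![MvPolynomial.eval z₀ (MvPolynomial.pderiv (Fin.last m) pt), MvPolynomial.eval z₀ pt;
     MvPolynomial.eval z₀ (MvPolynomial.pderiv (Fin.last m) p), MvPolynomial.eval z₀ p]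

/-- The partial derivative in the last variable. -/
def derivLast {m : ℕ} (f : (Fin (m + 1) → ℂ) → ℂ) (z : Fin (m + 1) → ℂ) : ℂ :=
  deriv (fun w : ℂ => f (Function.update z (Fin.last m) w)) (z (Fin.last m))

/-- `g` belongs to `L^s` of some neighbourhood of `(1, …, 1)` in the torus, in the angular
coordinates `θ ↦ (e^{iθ_1}, …, e^{iθ_d})` (`torusMap 0 1`), in which the measure of the torus
is Lebesgue measure up to a constant factor. -/
def MemLpNearOne {d : ℕ} (g : (Fin d → ℂ) → ℂ) (s : ℝ) : Prop :=
  ∃ U ∈ 𝓝 (0 : Fin d → ℝ),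
    MemLp (fun θ : Fin d → ℝ => g (torusMap 0 1 θ)) (ENNReal.ofReal s) (volume.restrict U)

/-- `s` is the local `z_d`-derivative integrability index of `f` at `(1, …, 1)`. -/
def IsLocalIndex {m : ℕ} (f : (Fin (m + 1) → ℂ) → ℂ) (s : ℝ) : Prop :=
  IsLUB {t : ℝ | 1 ≤ t ∧ MemLpNearOne (derivLast f) t} s

end RIF

end

noncomputable section

namespace RIF

open MvPolynomial

variable {m d : ℕ}

/-! ### Polynomials on the torus and on the polydisk -/

/-! Freezing `ẑ` makes `φ` a Möbius map of `z_d`, so `φ^N` is the Möbius map of the `N`-th power of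
the slice matrix `M`. On the torus `M = (t ū, t v̄; v, u)` with `|t| = 1`. Products keep this shape
(`eval_polyMatrix_pow_of_mem_torus`), and up to a unimodular factor the determinant is the defect `D
= |p₁|² - |p₂|²`; hence the defect of the `N`-th power is `D^N` (`defect_iter`). If `(v_N, u_N)` is
the second row of `M^N`, the quotient rule gives `|∂φ^N/∂z_d| = D^N / |u_N + z_d v_N|²`, a Poisson
kernel in `z_d` (`derivLast_sliceIter`).

The integral of the `(1+s)`-th power of this kernel over a fibre is comparable to `D^(-Ns)`. Above,
one factor has mean one and the others are `O(D^(-N))`; below, the kernel has size `D^(-N)` on an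
interval of length `D^N` next to its peak. So `∂φ^N/∂z_d` is in `L^(1+s)` near the singularity
exactly when `D^(-Ns)` is integrable near `(1,…,1)` in `ẑ` (`memLp_iff_lintegral_rpow`). Only the
product `Ns` enters, so passing from `1` to `N` divides the excess of the index over `1` by `N`.

The lower bound needs the peak to tend to `z_d = 1`, which follows from `u_N(1) + v_N(1) = 0` once
`u_N(1) ≠ 0`. If `u_N(1)` vanished, so would all of `M(1)^N`: this is excluded by hypothesis for `d
≥ 3`, and for `d = 2` it would give numerator and denominator the common factor `z₁ - 1`, against
full polydegree (`isRelPrime_of_hasPolydegree`). Stability of the iterates follows from the maximum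
principle on analytic disks through a given point with boundary in the torus
(`norm_reflect_slice_lt`). -/

theorem infinite_norm_eq_one : {w : ℂ | ‖w‖ = 1}.Infinite := by
  refine Set.infinite_of_injOn_mapsTo (s := Set.Ioo (0 : ℝ) 1)
    (f := fun t : ℝ => Complex.exp (t * Complex.I)) ?_ ?_ (Set.Ioo_infinite one_pos)
  · intro x hx y hy hxy
    have h : ∀ t ∈ Set.Ioo (0 : ℝ) 1, (Complex.exp (t * Complex.I)).arg = t := fun t ht =>
      Complex.arg_exp_mul_I t ▸ (toIocMod_eq_self _).2
        ⟨by linarith [ht.1, Real.pi_pos], by linarith [ht.2, Real.pi_gt_three]⟩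
    rw [← h x hx, ← h y hy]
    exact congrArg Complex.arg hxy
  · intro x _
    exact Complex.norm_exp_ofReal_mul_I x

theorem eq_of_eval_eq_on_torus {p q : MvPolynomial (Fin d) ℂ}
    (h : ∀ z ∈ torus d, eval z p = eval z q) : p = q :=
  funext_set (fun _ => {w : ℂ | ‖w‖ = 1}) (fun _ => infinite_norm_eq_one)
    fun z hz => h z fun j => hz j (Set.mem_univ j)

theorem eq_of_eval_eq_on_polydisk {p q : MvPolynomial (Fin d) ℂ}
    (h : ∀ z ∈ polydisk d, eval z p = eval z q) : p = q :=
  funext_set (fun _ => Metric.ball (0 : ℂ) 1)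
    (fun _ => infinite_of_mem_nhds 0 (Metric.ball_mem_nhds _ one_pos))
    fun z hz => h z fun j => by simpa using hz j (Set.mem_univ j)

/-- The value of the monomial `z^k`. -/
def mon (k : Fin d → ℕ) (z : Fin d → ℂ) : ℂ := ∏ j, z j ^ k j

theorem norm_mon (k : Fin d → ℕ) {z : Fin d → ℂ} (hz : z ∈ torus d) : ‖mon k z‖ = 1 := by
  simp [mon, norm_prod, norm_pow, hz _]

theorem mon_mul_conj (k : Fin d → ℕ) {z : Fin d → ℂ} (hz : z ∈ torus d) :
    mon k z * conj (mon k z) = 1 := by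
  rw [Complex.mul_conj, Complex.normSq_eq_norm_sq, norm_mon k hz]; simp

theorem eval_reflect_of_mem_torus {k : Fin d → ℕ} {p : MvPolynomial (Fin d) ℂ}
    (hk : ∀ j, p.degreeOf j ≤ k j) {z : Fin d → ℂ} (hz : z ∈ torus d) :
    eval z (reflect k p) = mon k z * conj (eval z p) := by
  have h0 : ∀ j, z j ≠ 0 := fun j => norm_ne_zero_iff.1 (by rw [hz j]; exact one_ne_zero)
  rw [eval_reflect k p hk z h0, mon]
  congr 4
  funext j
  rw [div_eq_iff ((map_ne_zero _).2 (h0 j)), Complex.mul_conj, Complex.normSq_eq_norm_sq, hz j]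
  simp

theorem degreeOf_reflect_le (k : Fin d → ℕ) (p : MvPolynomial (Fin d) ℂ) (j : Fin d) :
    (reflect k p).degreeOf j ≤ k j := by
  refine (degreeOf_sum_le j _ _).trans (Finset.sup_le fun α _ => ?_)
  by_cases h : conj (p.coeff α) = 0
  · simp [h]
  · rw [degreeOf_monomial_eq _ _ h]
    simp

/-- A polynomial is determined by its values on the torus, so reflections can be identified there,
with no bookkeeping of exponents. -/
theorem eq_reflect_of_eval {k : Fin d → ℕ} {p q : MvPolynomial (Fin d) ℂ}
    (hk : ∀ j, p.degreeOf j ≤ k j)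
    (h : ∀ z ∈ torus d, eval z q = mon k z * conj (eval z p)) : reflect k p = q :=
  eq_of_eval_eq_on_torus fun z hz => by rw [eval_reflect_of_mem_torus hk hz, h z hz]

/-! ### Polynomials of degree one in the last variable -/

/-- The polynomial `a + z_d b`, where `a` and `b` do not depend on the last variable. -/
def ofSlice (a b : MvPolynomial (Fin m) ℂ) : MvPolynomial (Fin (m + 1)) ℂ :=
  rename Fin.castSucc a + X (Fin.last m) * rename Fin.castSucc b

theorem eval_ofSlice (a b : MvPolynomial (Fin m) ℂ) (z : Fin (m + 1) → ℂ) :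
    eval z (ofSlice a b) =
      eval (fun j => z j.castSucc) a + z (Fin.last m) * eval (fun j => z j.castSucc) b := by
  simp [ofSlice, eval_rename, Function.comp_def]

@[simp] theorem polydeg_castSucc (n : Fin m → ℕ) (j : Fin m) : polydeg n j.castSucc = n j := by
  simp [polydeg]

@[simp] theorem polydeg_last (n : Fin m → ℕ) : polydeg n (Fin.last m) = 1 := by
  simp [polydeg]

theorem mon_polydeg (n : Fin m → ℕ) (z : Fin (m + 1) → ℂ) :
    mon (polydeg n) z = mon n (fun j => z j.castSucc) * z (Fin.last m) := by
  simp [mon, Fin.prod_univ_castSucc]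

theorem degreeOf_last_rename (a : MvPolynomial (Fin m) ℂ) :
    (rename Fin.castSucc a).degreeOf (Fin.last m) = 0 := by
  classical
  by_contra h
  obtain ⟨j, -, hj⟩ := Finset.mem_image.1
    (vars_rename Fin.castSucc a (mem_vars_iff_degreeOf_ne_zero.2 h))
  exact (Fin.castSucc_lt_last j).ne hj

theorem degreeOf_ofSlice_le {n : Fin m → ℕ} {a b : MvPolynomial (Fin m) ℂ}
    (ha : ∀ j, a.degreeOf j ≤ n j) (hb : ∀ j, b.degreeOf j ≤ n j) (j : Fin (m + 1)) :
    (ofSlice a b).degreeOf j ≤ polydeg n j := by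
  refine (degreeOf_add_le _ _ _).trans (max_le ?_ ((degreeOf_mul_le _ _ _).trans ?_))
  · refine Fin.lastCases ?_ (fun i => ?_) j
    · simp [degreeOf_last_rename]
    · rw [degreeOf_rename_of_injective (Fin.castSucc_injective m), polydeg_castSucc]
      exact ha i
  · refine Fin.lastCases ?_ (fun i => ?_) j
    · simp [degreeOf_last_rename]
    · rw [degreeOf_rename_of_injective (Fin.castSucc_injective m), polydeg_castSucc,
        degreeOf_X_of_ne (Fin.castSucc_lt_last i).ne, zero_add]
      exact hb i

theorem mem_torus_castSucc {z : Fin (m + 1) → ℂ} (hz : z ∈ torus (m + 1)) :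
    (fun j : Fin m => z j.castSucc) ∈ torus m := fun j => hz j.castSucc

theorem mem_polydisk_castSucc {z : Fin (m + 1) → ℂ} (hz : z ∈ polydisk (m + 1)) :
    (fun j : Fin m => z j.castSucc) ∈ polydisk m := fun j => hz j.castSucc

theorem reflect_ofSlice {n : Fin m → ℕ} {a b a' b' : MvPolynomial (Fin m) ℂ}
    (ha : ∀ j, a.degreeOf j ≤ n j) (hb : ∀ j, b.degreeOf j ≤ n j)
    (ha' : ∀ z ∈ torus m, eval z a' = mon n z * conj (eval z a))
    (hb' : ∀ z ∈ torus m, eval z b' = mon n z * conj (eval z b)) :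
    reflect (polydeg n) (ofSlice a b) = ofSlice b' a' := by
  refine eq_reflect_of_eval (degreeOf_ofSlice_le ha hb) fun z hz => ?_
  have h1 : z (Fin.last m) * conj (z (Fin.last m)) = 1 := by
    rw [Complex.mul_conj, Complex.normSq_eq_norm_sq, hz]; simp
  rw [eval_ofSlice, eval_ofSlice, ha' _ (mem_torus_castSucc hz), hb' _ (mem_torus_castSucc hz),
    mon_polydeg, map_add, map_mul]
  linear_combination (-mon n (fun j => z j.castSucc) *
    conj (eval (fun j => z j.castSucc) b)) * h1

theorem exists_eq_rename {n : Fin m → ℕ} {q : MvPolynomial (Fin (m + 1)) ℂ}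
    (hq : ∀ j : Fin m, q.degreeOf j.castSucc ≤ n j) (h0 : q.degreeOf (Fin.last m) = 0) :
    ∃ a : MvPolynomial (Fin m) ℂ, (∀ j, a.degreeOf j ≤ n j) ∧ rename Fin.castSucc a = q := by
  obtain ⟨a, rfl⟩ := exists_rename_eq_of_vars_subset_range q Fin.castSucc
    (Fin.castSucc_injective m) (by
      intro i hi
      induction i using Fin.lastCases with
      | last => exact absurd h0 (mem_vars_iff_degreeOf_ne_zero.1 hi)
      | cast i => exact ⟨i, rfl⟩)
  refine ⟨a, fun j => ?_, rfl⟩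
  rw [← degreeOf_rename_of_injective (Fin.castSucc_injective m)]
  exact hq j

theorem exists_eq_ofSlice {n : Fin m → ℕ} {p : MvPolynomial (Fin (m + 1)) ℂ}
    (hp : ∀ j, p.degreeOf j ≤ polydeg n j) :
    ∃ a b : MvPolynomial (Fin m) ℂ, (∀ j, a.degreeOf j ≤ n j) ∧ (∀ j, b.degreeOf j ≤ n j) ∧
      p = ofSlice a b := by
  classical
  let s := Finsupp.single (Fin.last m) 1
  have hle : ∀ α ∈ p.support, ∀ j, α j ≤ polydeg n j := fun α hα j =>
    (monomial_le_degreeOf j hα).trans (hp j)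
  let u := ∑ α ∈ p.support with α (Fin.last m) = 0, monomial α (p.coeff α)
  let v := ∑ α ∈ p.support with ¬ α (Fin.last m) = 0, monomial (α - s) (p.coeff α)
  have key : ∀ (α : Fin (m + 1) →₀ ℕ) (c : ℂ) (j), (monomial α c).degreeOf j ≤ α j := by
    intro α c j
    by_cases h : c = 0
    · simp [h]
    · rw [degreeOf_monomial_eq _ _ h]
  obtain ⟨a, ha, hau⟩ := exists_eq_rename (n := n) (q := u)
    (fun j => (degreeOf_sum_le _ _ _).trans (Finset.sup_le fun α hα => (key _ _ _).trans
      (by simpa using hle α (Finset.mem_filter.1 hα).1 j.castSucc)))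
    (Nat.le_zero.1 ((degreeOf_sum_le _ _ _).trans (Finset.sup_le fun α hα => (key _ _ _).trans
      (Finset.mem_filter.1 hα).2.le)))
  obtain ⟨b, hb, hbv⟩ := exists_eq_rename (n := n) (q := v)
    (fun j => (degreeOf_sum_le _ _ _).trans (Finset.sup_le fun α hα => (key _ _ _).trans
      ((Nat.sub_le _ _).trans (by simpa using hle α (Finset.mem_filter.1 hα).1 j.castSucc))))
    (Nat.le_zero.1 ((degreeOf_sum_le _ _ _).trans (Finset.sup_le fun α hα => (key _ _ _).trans
      (by simpa [s, Nat.sub_eq_zero_iff_le] using hle α (Finset.mem_filter.1 hα).1 (Fin.last m)))))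
  refine ⟨a, b, ha, hb, ?_⟩
  rw [ofSlice, hau, hbv, Finset.mul_sum]
  conv_lhs => rw [p.as_sum, ← Finset.sum_filter_add_sum_filter_not _
    (fun α => α (Fin.last m) = 0)]
  congr 1
  refine Finset.sum_congr rfl fun α hα => ?_
  rw [X, monomial_mul, one_mul, add_tsub_cancel_of_le]
  simpa [s, Finsupp.single_le_iff, Nat.one_le_iff_ne_zero] using (Finset.mem_filter.1 hα).2

/-! ### The slice matrix as a polynomial matrix, and its powers -/

/-- The slice matrix of `ofSlice a b`, as a matrix of polynomials. -/
def polyMatrix (n : Fin m → ℕ) (a b : MvPolynomial (Fin m) ℂ) :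
    Matrix (Fin 2) (Fin 2) (MvPolynomial (Fin m) ℂ) :=
  !![reflect n a, reflect n b; b, a]

theorem polyMatrix_pow_succ_zero (n : Fin m → ℕ) (a b : MvPolynomial (Fin m) ℂ) (N : ℕ)
    (j : Fin 2) : (polyMatrix n a b ^ (N + 1)) 0 j =
      reflect n a * (polyMatrix n a b ^ N) 0 j + reflect n b * (polyMatrix n a b ^ N) 1 j := by
  rw [pow_succ', Matrix.mul_apply, Fin.sum_univ_two]; simp [polyMatrix]

theorem polyMatrix_pow_succ_one (n : Fin m → ℕ) (a b : MvPolynomial (Fin m) ℂ) (N : ℕ)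
    (j : Fin 2) : (polyMatrix n a b ^ (N + 1)) 1 j =
      b * (polyMatrix n a b ^ N) 0 j + a * (polyMatrix n a b ^ N) 1 j := by
  rw [pow_succ', Matrix.mul_apply, Fin.sum_univ_two]; simp [polyMatrix]

theorem degreeOf_polyMatrix_pow_le {n : Fin m → ℕ} {a b : MvPolynomial (Fin m) ℂ}
    (ha : ∀ j, a.degreeOf j ≤ n j) (hb : ∀ j, b.degreeOf j ≤ n j) (N : ℕ) (i k : Fin 2)
    (j : Fin m) : ((polyMatrix n a b ^ N) i k).degreeOf j ≤ N * n j := by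
  induction N generalizing i with
  | zero => fin_cases i <;> fin_cases k <;> simp
  | succ N ih =>
    have h : ∀ (f : MvPolynomial (Fin m) ℂ) (i : Fin 2), f.degreeOf j ≤ n j →
        (f * (polyMatrix n a b ^ N) i k).degreeOf j ≤ (N + 1) * n j := fun f i hf => by
      refine (degreeOf_mul_le _ _ _).trans ?_
      rw [add_mul, one_mul, add_comm]
      exact Nat.add_le_add (ih i) hf
    revert i
    rw [Fin.forall_fin_two, polyMatrix_pow_succ_zero, polyMatrix_pow_succ_one]
    exact ⟨(degreeOf_add_le _ _ _).trans
        (max_le (h _ _ (degreeOf_reflect_le _ _ _)) (h _ _ (degreeOf_reflect_le _ _ _))),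
      (degreeOf_add_le _ _ _).trans (max_le (h _ _ (hb j)) (h _ _ (ha j)))⟩

/-- Matrices `(t ū, t v̄; v, u)` with `|t| = 1` are closed under multiplication, and the factors `t`
multiply. -/
theorem eval_polyMatrix_pow_of_mem_torus {n : Fin m → ℕ} {a b : MvPolynomial (Fin m) ℂ}
    (ha : ∀ j, a.degreeOf j ≤ n j) (hb : ∀ j, b.degreeOf j ≤ n j) (N : ℕ)
    {z : Fin m → ℂ} (hz : z ∈ torus m) :
    eval z ((polyMatrix n a b ^ N) 0 0) =
        mon n z ^ N * conj (eval z ((polyMatrix n a b ^ N) 1 1)) ∧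
      eval z ((polyMatrix n a b ^ N) 0 1) =
        mon n z ^ N * conj (eval z ((polyMatrix n a b ^ N) 1 0)) := by
  induction N with
  | zero => simp
  | succ N ih =>
    have ht' : mon n z ^ N * conj (mon n z) ^ N = 1 := by
      rw [← mul_pow, mon_mul_conj n hz, one_pow]
    obtain ⟨h0, h1⟩ := ih
    simp only [polyMatrix_pow_succ_zero, polyMatrix_pow_succ_one, map_add, map_mul,
      eval_reflect_of_mem_torus ha hz, eval_reflect_of_mem_torus hb hz, h0, h1, map_pow,
      Complex.conj_conj, pow_succ]
    constructor
    · linear_combination (-mon n z * conj (eval z b) *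
        eval z ((polyMatrix n a b ^ N) 1 0)) * ht'
    · linear_combination (-mon n z * conj (eval z b) *
        eval z ((polyMatrix n a b ^ N) 1 1)) * ht'

theorem mon_mul (n : Fin d → ℕ) (N : ℕ) (z : Fin d → ℂ) :
    mon (fun j => N * n j) z = mon n z ^ N := by
  simp only [mon, ← Finset.prod_pow]
  exact Finset.prod_congr rfl fun j _ => by rw [mul_comm, pow_mul]

/-- The denominator of the `N`-th slice iterate. -/
def iterDen (n : Fin m → ℕ) (a b : MvPolynomial (Fin m) ℂ) (N : ℕ) :
    MvPolynomial (Fin (m + 1)) ℂ :=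
  ofSlice ((polyMatrix n a b ^ N) 1 1) ((polyMatrix n a b ^ N) 1 0)

/-- The numerator of the `N`-th slice iterate. -/
def iterNum (n : Fin m → ℕ) (a b : MvPolynomial (Fin m) ℂ) (N : ℕ) :
    MvPolynomial (Fin (m + 1)) ℂ :=
  ofSlice ((polyMatrix n a b ^ N) 0 1) ((polyMatrix n a b ^ N) 0 0)

/-! ### Slice iterates as quotients of polynomials -/

section Iterates

variable {n : Fin m → ℕ} {a b : MvPolynomial (Fin m) ℂ}

theorem degreeOf_iterDen_le (ha : ∀ j, a.degreeOf j ≤ n j) (hb : ∀ j, b.degreeOf j ≤ n j)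
    (N : ℕ) (j : Fin (m + 1)) :
    (iterDen n a b N).degreeOf j ≤ polydeg (fun j => N * n j) j :=
  degreeOf_ofSlice_le (n := fun j => N * n j) (degreeOf_polyMatrix_pow_le ha hb N 1 1)
    (degreeOf_polyMatrix_pow_le ha hb N 1 0) j

theorem degreeOf_iterNum_le (ha : ∀ j, a.degreeOf j ≤ n j) (hb : ∀ j, b.degreeOf j ≤ n j)
    (N : ℕ) (j : Fin (m + 1)) :
    (iterNum n a b N).degreeOf j ≤ polydeg (fun j => N * n j) j :=
  degreeOf_ofSlice_le (n := fun j => N * n j) (degreeOf_polyMatrix_pow_le ha hb N 0 1)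
    (degreeOf_polyMatrix_pow_le ha hb N 0 0) j

theorem reflect_iterDen (ha : ∀ j, a.degreeOf j ≤ n j) (hb : ∀ j, b.degreeOf j ≤ n j) (N : ℕ) :
    reflect (polydeg fun j => N * n j) (iterDen n a b N) = iterNum n a b N :=
  reflect_ofSlice (n := fun j => N * n j) (degreeOf_polyMatrix_pow_le ha hb N 1 1)
    (degreeOf_polyMatrix_pow_le ha hb N 1 0)
    (fun z hz => by rw [mon_mul]; exact (eval_polyMatrix_pow_of_mem_torus ha hb N hz).1)
    (fun z hz => by rw [mon_mul]; exact (eval_polyMatrix_pow_of_mem_torus ha hb N hz).2)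

theorem iterDen_zero : iterDen n a b 0 = 1 := by simp [iterDen, ofSlice]

theorem iterNum_zero : iterNum n a b 0 = X (Fin.last m) := by simp [iterNum, ofSlice]

theorem reflect_ofSlice_eq (ha : ∀ j, a.degreeOf j ≤ n j) (hb : ∀ j, b.degreeOf j ≤ n j) :
    reflect (polydeg n) (ofSlice a b) = ofSlice (reflect n b) (reflect n a) :=
  reflect_ofSlice ha hb (fun _ hz => eval_reflect_of_mem_torus ha hz)
    (fun _ hz => eval_reflect_of_mem_torus hb hz)

theorem eval_iterDen_succ (N : ℕ) (z : Fin (m + 1) → ℂ) :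
    eval z (iterDen n a b (N + 1)) =
      eval (fun j => z j.castSucc) a * eval z (iterDen n a b N) +
        eval (fun j => z j.castSucc) b * eval z (iterNum n a b N) := by
  simp only [iterDen, iterNum, eval_ofSlice, polyMatrix_pow_succ_one, map_add, map_mul]
  ring

theorem eval_iterNum_succ (N : ℕ) (z : Fin (m + 1) → ℂ) :
    eval z (iterNum n a b (N + 1)) =
      eval (fun j => z j.castSucc) (reflect n b) * eval z (iterDen n a b N) +
        eval (fun j => z j.castSucc) (reflect n a) * eval z (iterNum n a b N) := by
  simp only [iterDen, iterNum, eval_ofSlice, polyMatrix_pow_succ_zero, map_add, map_mul]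
  ring

theorem quot_update (ha : ∀ j, a.degreeOf j ≤ n j) (hb : ∀ j, b.degreeOf j ≤ n j)
    (z : Fin (m + 1) → ℂ) (w : ℂ) :
    quot (polydeg n) (ofSlice a b) (Function.update z (Fin.last m) w) =
      (eval (fun j => z j.castSucc) (reflect n b) +
        w * eval (fun j => z j.castSucc) (reflect n a)) /
      (eval (fun j => z j.castSucc) a + w * eval (fun j => z j.castSucc) b) := by
  have h : ∀ j : Fin m, Function.update z (Fin.last m) w j.castSucc = z j.castSucc := fun j =>
    Function.update_of_ne (Fin.castSucc_lt_last j).ne _ _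
  simp only [quot, reflect_ofSlice_eq ha hb, eval_ofSlice, h, Function.update_self]

theorem sliceIter_succ (f : (Fin (m + 1) → ℂ) → ℂ) (N : ℕ) (z : Fin (m + 1) → ℂ) :
    sliceIter f (N + 1) z = f (Function.update z (Fin.last m) (sliceIter f N z)) := by
  simp only [sliceIter, Function.iterate_succ_apply']

/-- Only the denominators before the last are required not to vanish: if the last one does, both
sides are divisions by zero. -/
theorem sliceIter_quot_eq (ha : ∀ j, a.degreeOf j ≤ n j) (hb : ∀ j, b.degreeOf j ≤ n j)
    {N : ℕ} {z : Fin (m + 1) → ℂ} (h : ∀ k < N, eval z (iterDen n a b k) ≠ 0) :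
    sliceIter (quot (polydeg n) (ofSlice a b)) N z =
      eval z (iterNum n a b N) / eval z (iterDen n a b N) := by
  induction N with
  | zero => simp [iterDen_zero, iterNum_zero, sliceIter]
  | succ N ih =>
    have h0 := h N (Nat.lt_succ_self N)
    rw [sliceIter_succ, ih fun k hk => h k (hk.trans (Nat.lt_succ_self N)), quot_update ha hb,
      eval_iterDen_succ, eval_iterNum_succ, ← mul_div_mul_right _ _ h0]
    congr 1 <;> field_simp

end Iterates

/-! ### Divisibility -/

theorem X_sub_C_dvd_sub_C_eval (c : ℂ) (p : MvPolynomial (Fin 1) ℂ) :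
    X 0 - C c ∣ p - C (eval (fun _ => c) p) := by
  induction p using MvPolynomial.induction_on with
  | C r => simp
  | add p q hp hq =>
    rw [map_add, C_add, add_sub_add_comm]
    exact dvd_add hp hq
  | mul_X p i hp =>
    rw [map_mul, eval_X, C_mul, Subsingleton.elim i 0,
      show p * X 0 - C (eval (fun _ => c) p) * C c =
        p * (X 0 - C c) + (p - C (eval (fun _ => c) p)) * C c by ring]
    exact dvd_add (dvd_mul_left _ _) (hp.mul_right _)

/-- In one variable a common zero is a common factor. This fails in several variables, whence the
extra hypothesis for `d ≥ 3`. -/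
theorem X_sub_C_dvd {c : ℂ} {p : MvPolynomial (Fin 1) ℂ} (h : eval (fun _ => c) p = 0) :
    X 0 - C c ∣ p := by
  simpa [h] using X_sub_C_dvd_sub_C_eval c p

theorem not_isUnit_X_sub_C (i : Fin d) (c : ℂ) : ¬ IsUnit (X i - C c : MvPolynomial (Fin d) ℂ) :=
  fun h => by
    have := h.map (eval fun _ : Fin d => c)
    simp at this

theorem isUnit_of_degreeOf_eq_zero {g : MvPolynomial (Fin d) ℂ} (hg : g ≠ 0)
    (h : ∀ j, g.degreeOf j = 0) : IsUnit g := by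
  have hv : g.vars = ∅ := Finset.eq_empty_of_forall_notMem fun j hj =>
    mem_vars_iff_degreeOf_ne_zero.1 hj (h j)
  rw [vars_eq_empty_iff_eq_C] at hv
  rw [hv] at hg ⊢
  exact (IsUnit.mk0 _ fun h0 => hg (by rw [h0, C_0])).map C

/-- If a quotient `Q / P` has full polydegree `k`, then `Q` and `P` are coprime. -/
theorem isRelPrime_of_hasPolydegree {k : Fin d → ℕ} {f : (Fin d → ℂ) → ℂ}
    {Q P : MvPolynomial (Fin d) ℂ} (hf : HasPolydegree f k)
    (hP : ∀ z ∈ polydisk d, eval z P ≠ 0) (hfQ : ∀ z ∈ polydisk d, f z = eval z Q / eval z P)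
    (hQk : ∀ j, Q.degreeOf j ≤ k j) (hPk : ∀ j, P.degreeOf j ≤ k j) : IsRelPrime Q P := by
  obtain ⟨q, r, hqr, hfq, hdeg⟩ := hf
  have hz0 : (0 : Fin d → ℂ) ∈ polydisk d := fun j => by simp
  have hP0 : P ≠ 0 := fun h => hP 0 hz0 (by simp [h])
  have hmul : q * P = r * Q := eq_of_eval_eq_on_polydisk fun z hz => by
    have := (hfq z hz).2.symm.trans (hfQ z hz)
    rw [div_eq_div_iff (hfq z hz).1 (hP z hz)] at this
    rw [map_mul, map_mul, this, mul_comm]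
  obtain ⟨g, rfl⟩ : r ∣ P := hqr.symm.dvd_of_dvd_mul_left (hmul ▸ dvd_mul_right r Q)
  have hr0 : r ≠ 0 := left_ne_zero_of_mul hP0
  have hg0 : g ≠ 0 := right_ne_zero_of_mul hP0
  obtain rfl : Q = q * g := mul_left_cancel₀ hr0 (by rw [← hmul]; ring)
  -- The degrees of `q * g` and `r * g` are at most `k`, which the larger degree of `q` and `r`
  -- already attains; nothing is left for `g`.
  have hg : IsUnit g := isUnit_of_degreeOf_eq_zero hg0 fun j => by
    have h1 := hPk j
    have h2 := hQk j
    have h3 := hdeg j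
    rw [degreeOf_mul_eq hr0 hg0] at h1
    by_cases hq0 : q = 0
    · simp [hq0] at h3; omega
    · rw [degreeOf_mul_eq hq0 hg0] at h2; omega
  rwa [isRelPrime_mul_unit_right_left hg, isRelPrime_mul_unit_right_right hg]

end RIF

end

noncomputable section

namespace RIF

open MvPolynomial

variable {m d : ℕ}

/-! ### Disk automorphisms -/

/-- The automorphism of the unit disk that sends `0` to `α`. -/
def diskAut (α ζ : ℂ) : ℂ := (ζ + α) / (1 + conj α * ζ)

theorem norm_sq_diskAut_aux (α ζ : ℂ) :
    ‖1 + conj α * ζ‖ ^ 2 - ‖ζ + α‖ ^ 2 = (1 - ‖α‖ ^ 2) * (1 - ‖ζ‖ ^ 2) := by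
  simp only [← Complex.normSq_eq_norm_sq, Complex.normSq_apply, Complex.add_re, Complex.add_im,
    Complex.mul_re, Complex.mul_im, Complex.conj_re, Complex.conj_im, Complex.one_re,
    Complex.one_im]
  ring

theorem diskAut_den_ne_zero {α ζ : ℂ} (hα : ‖α‖ < 1) (hζ : ‖ζ‖ ≤ 1) : 1 + conj α * ζ ≠ 0 := by
  intro h
  have h1 : ‖conj α * ζ‖ = 1 := by rw [eq_neg_of_add_eq_zero_right h]; simp
  rw [norm_mul, RCLike.norm_conj] at h1
  nlinarith [norm_nonneg α, norm_nonneg ζ]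

theorem norm_diskAut_lt_one {α ζ : ℂ} (hα : ‖α‖ < 1) (hζ : ‖ζ‖ < 1) : ‖diskAut α ζ‖ < 1 := by
  have h0 := norm_pos_iff.2 (diskAut_den_ne_zero hα hζ.le)
  have h := norm_sq_diskAut_aux α ζ
  have h1 : 0 < (1 - ‖α‖ ^ 2) * (1 - ‖ζ‖ ^ 2) := by
    apply mul_pos <;> nlinarith [norm_nonneg α, norm_nonneg ζ]
  rw [diskAut, norm_div, div_lt_one h0]
  exact lt_of_pow_lt_pow_left₀ 2 h0.le (by linarith)

theorem norm_diskAut_eq_one {α ζ : ℂ} (hα : ‖α‖ < 1) (hζ : ‖ζ‖ = 1) : ‖diskAut α ζ‖ = 1 := by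
  have h0 := norm_pos_iff.2 (diskAut_den_ne_zero hα hζ.le)
  have h := norm_sq_diskAut_aux α ζ
  rw [diskAut, norm_div, div_eq_one_iff_eq h0.ne']
  exact (pow_left_inj₀ (norm_nonneg _) h0.le two_ne_zero).1 (by rw [hζ] at h; linarith)

theorem diskAut_injOn {α : ℂ} (hα : ‖α‖ < 1) : Set.InjOn (diskAut α) {ζ | ‖ζ‖ = 1} := by
  intro ζ hζ ζ' hζ' h
  rw [diskAut, diskAut, div_eq_div_iff (diskAut_den_ne_zero hα (le_of_eq hζ))
    (diskAut_den_ne_zero hα (le_of_eq hζ'))] at h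
  have h1 : (ζ - ζ') * (1 - α * conj α) = 0 := by linear_combination h
  rcases mul_eq_zero.1 h1 with h2 | h2
  · exact sub_eq_zero.1 h2
  · rw [Complex.mul_conj, Complex.normSq_eq_norm_sq, sub_eq_zero] at h2
    have h3 : ‖α‖ ^ 2 = 1 := by exact_mod_cast h2.symm
    nlinarith [norm_nonneg α]

theorem differentiableAt_diskAut {α ζ : ℂ} (hα : ‖α‖ < 1) (hζ : ‖ζ‖ ≤ 1) :
    DifferentiableAt ℂ (diskAut α) ζ := by
  unfold diskAut
  exact DifferentiableAt.div (by fun_prop) (by fun_prop) (diskAut_den_ne_zero hα hζ)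

theorem differentiableAt_eval {c : ℂ → Fin d → ℂ} {ζ : ℂ}
    (hc : ∀ j, DifferentiableAt ℂ (fun ζ => c ζ j) ζ) (p : MvPolynomial (Fin d) ℂ) :
    DifferentiableAt ℂ (fun ζ => eval (c ζ) p) ζ := by
  induction p using MvPolynomial.induction_on with
  | C r => simp
  | add p q hp hq => simp only [map_add]; exact hp.fun_add hq
  | mul_X p i hp => simp only [map_mul, eval_X]; exact hp.fun_mul (hc i)

/-! ### Stability of the iterates -/

/-- The defect `|p₁|² - |p₂|²` of `p = p₁ + z_d p₂`. -/
def defect (a b : MvPolynomial (Fin m) ℂ) (z : Fin m → ℂ) : ℝ := ‖eval z a‖ ^ 2 - ‖eval z b‖ ^ 2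

variable {n : Fin m → ℕ} {a b : MvPolynomial (Fin m) ℂ}

/-- The matrix `(t ū, t v̄; v, u)` preserves the form `|denominator|² - |numerator|²` up to the
factor `|u|² - |v|²`. -/
theorem norm_sq_sub_norm_sq_slice (t u v w : ℂ) (ht : ‖t‖ = 1) :
    ‖u + w * v‖ ^ 2 - ‖t * conj v + w * (t * conj u)‖ ^ 2 =
      (‖u‖ ^ 2 - ‖v‖ ^ 2) * (1 - ‖w‖ ^ 2) := by
  rw [show t * conj v + w * (t * conj u) = t * (conj v + w * conj u) by ring, norm_mul, ht, one_mul]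
  simp only [← Complex.normSq_eq_norm_sq, Complex.normSq_apply, Complex.add_re, Complex.add_im,
    Complex.mul_re, Complex.mul_im, Complex.conj_re, Complex.conj_im]
  ring

theorem snoc_mem_polydisk {z : Fin m → ℂ} (hz : z ∈ polydisk m) {w : ℂ} (hw : ‖w‖ < 1) :
    (Fin.snoc z w : Fin (m + 1) → ℂ) ∈ polydisk (m + 1) := by
  intro j
  induction j using Fin.lastCases with
  | last => simpa
  | cast j => simpa using hz j

theorem snoc_mem_torus {z : Fin m → ℂ} (hz : z ∈ torus m) {w : ℂ} (hw : ‖w‖ = 1) :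
    (Fin.snoc z w : Fin (m + 1) → ℂ) ∈ torus (m + 1) := by
  intro j
  induction j using Fin.lastCases with
  | last => simpa
  | cast j => simpa using hz j

theorem eval_snoc_ofSlice (a b : MvPolynomial (Fin m) ℂ) (z : Fin m → ℂ) (w : ℂ) :
    eval (Fin.snoc z w : Fin (m + 1) → ℂ) (ofSlice a b) = eval z a + w * eval z b := by
  simp [eval_ofSlice]

/-- At an interior point with `|b| > |a|`, the choice `z_d = -a/b` would give a zero in the
polydisk. Boundary points are reached by the dilations `r z`, `r → 1`. -/
theorem norm_eval_le_of_isStable (hs : IsStable (ofSlice a b)) {z : Fin m → ℂ}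
    (hz : ∀ j, ‖z j‖ ≤ 1) : ‖eval z b‖ ≤ ‖eval z a‖ := by
  have hin : ∀ z ∈ polydisk m, ‖eval z b‖ ≤ ‖eval z a‖ := by
    intro z hz
    by_contra! h
    have hb : eval z b ≠ 0 := norm_pos_iff.1 ((norm_nonneg _).trans_lt h)
    refine hs _ (snoc_mem_polydisk hz (w := -(eval z a / eval z b)) ?_) ?_
    · rw [norm_neg, norm_div, div_lt_one (norm_pos_iff.2 hb)]
      exact h
    · rw [eval_snoc_ofSlice]
      field_simp
      ring
  have hc : ∀ q : MvPolynomial (Fin m) ℂ,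
      Continuous fun r : ℝ => ‖eval (fun j => (r : ℂ) * z j) q‖ := fun q =>
    ((MvPolynomial.continuous_eval q).comp
      (continuous_pi fun j => Complex.continuous_ofReal.mul continuous_const)).norm
  have h1 : (1 : ℝ) ∈ closure (Set.Ico (0 : ℝ) 1) := by
    rw [closure_Ico zero_ne_one]; exact ⟨zero_le_one, le_rfl⟩
  have := le_on_closure (s := Set.Ico (0 : ℝ) 1)
    (fun r hr => hin _ fun j => by
      rw [norm_mul, Complex.norm_real, Real.norm_of_nonneg hr.1]
      nlinarith [hr.1, hr.2, hz j, norm_nonneg (z j)])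
    (hc b).continuousOn (hc a).continuousOn h1
  simpa using this

theorem defect_nonneg (hs : IsStable (ofSlice a b)) {z : Fin m → ℂ} (hz : z ∈ torus m) :
    0 ≤ defect a b z :=
  sub_nonneg.2 (pow_le_pow_left₀ (norm_nonneg _)
    (norm_eval_le_of_isStable hs fun j => (hz j).le) 2)

/-- Above each zero of the defect lies a zero of `p` on the torus, with `z_d = -a/b` (or `1` if `a =
b = 0`). -/
theorem finite_defect_eq_zero
    (hf : {ζ ∈ torus (m + 1) | eval ζ (ofSlice a b) = 0}.Finite) :
    {z ∈ torus m | defect a b z = 0}.Finite := by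
  refine (hf.image fun ζ j => ζ (Fin.castSucc j)).subset ?_
  rintro z ⟨hz, h0⟩
  have hab : ‖eval z a‖ = ‖eval z b‖ :=
    (pow_left_inj₀ (norm_nonneg _) (norm_nonneg _) two_ne_zero).1 (sub_eq_zero.1 h0)
  obtain ⟨w, hw, hw0⟩ : ∃ w : ℂ, ‖w‖ = 1 ∧ eval z a + w * eval z b = 0 := by
    by_cases hb : eval z b = 0
    · exact ⟨1, by simp, by rw [hb, norm_zero, norm_eq_zero] at hab; simp [hb, hab]⟩
    · refine ⟨-(eval z a / eval z b), ?_, ?_⟩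
      · rw [norm_neg, norm_div, hab, div_self (norm_ne_zero_iff.2 hb)]
      · field_simp
        ring
  exact ⟨Fin.snoc z w, ⟨snoc_mem_torus hz hw, by rw [eval_snoc_ofSlice, hw0]⟩, by simp⟩

/-- If `a` vanished, so would `b`, and `p` would vanish on a whole circle over `z`. -/
theorem eval_ne_zero_of_finite (hs : IsStable (ofSlice a b))
    (hf : {ζ ∈ torus (m + 1) | eval ζ (ofSlice a b) = 0}.Finite) {z : Fin m → ℂ}
    (hz : z ∈ torus m) : eval z a ≠ 0 := by
  intro ha
  have hb : eval z b = 0 := by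
    have := norm_eval_le_of_isStable hs fun j => (hz j).le
    rwa [ha, norm_zero, norm_le_zero_iff] at this
  refine Set.infinite_of_injOn_mapsTo (f := fun w => (Fin.snoc z w : Fin (m + 1) → ℂ)) ?_ ?_
    infinite_norm_eq_one hf
  · intro w _ w' _ h
    simpa using congrFun h (Fin.last m)
  · intro w hw
    exact ⟨snoc_mem_torus hz hw, by simp [eval_snoc_ofSlice, ha, hb]⟩

/-- The analytic disk `ζ ↦ (diskAut (z j) ζ)_j` passes through `z` at `ζ = 0` and has its boundary
in the torus, where the quotient is at most one in modulus. Equality at the centre would force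
modulus one on the whole boundary circle, so the defect would vanish at infinitely many points. -/
theorem norm_reflect_slice_lt (hm : 0 < m) (ha : ∀ j, a.degreeOf j ≤ n j)
    (hb : ∀ j, b.degreeOf j ≤ n j) (hs : IsStable (ofSlice a b))
    (hf : {ζ ∈ torus (m + 1) | eval ζ (ofSlice a b) = 0}.Finite) {z : Fin m → ℂ}
    (hz : z ∈ polydisk m) {w : ℂ} (hw : ‖w‖ < 1) :
    ‖eval z (reflect n b) + w * eval z (reflect n a)‖ < ‖eval z a + w * eval z b‖ := by
  let c : ℂ → Fin m → ℂ := fun ζ j => diskAut (z j) ζ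
  let g : ℂ → ℂ := fun ζ => (eval (c ζ) (reflect n b) + w * eval (c ζ) (reflect n a)) /
    (eval (c ζ) a + w * eval (c ζ) b)
  have hct : ∀ ζ, ‖ζ‖ = 1 → c ζ ∈ torus m := fun ζ hζ j => norm_diskAut_eq_one (hz j) hζ
  have hcd : ∀ ζ, ‖ζ‖ < 1 → c ζ ∈ polydisk m := fun ζ hζ j => norm_diskAut_lt_one (hz j) hζ
  have hsq : ∀ ζ, ‖ζ‖ = 1 → ‖eval (c ζ) a + w * eval (c ζ) b‖ ^ 2 -
      ‖eval (c ζ) (reflect n b) + w * eval (c ζ) (reflect n a)‖ ^ 2 =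
        defect a b (c ζ) * (1 - ‖w‖ ^ 2) := fun ζ hζ => by
    rw [eval_reflect_of_mem_torus ha (hct ζ hζ), eval_reflect_of_mem_torus hb (hct ζ hζ),
      norm_sq_sub_norm_sq_slice _ _ _ _ (norm_mon n (hct ζ hζ)), defect]
  have hden : ∀ ζ, ‖ζ‖ ≤ 1 → eval (c ζ) a + w * eval (c ζ) b ≠ 0 := by
    intro ζ hζ
    rcases hζ.lt_or_eq with h | h
    · rw [← eval_snoc_ofSlice]
      exact hs _ (snoc_mem_polydisk (hcd ζ h) hw)
    · intro h0
      have h1 : ‖eval (c ζ) a‖ = ‖w‖ * ‖eval (c ζ) b‖ := by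
        rw [eq_neg_of_add_eq_zero_left h0, norm_neg, norm_mul]
      have h2 := norm_eval_le_of_isStable hs fun j => (hct ζ h j).le
      have h3 := norm_pos_iff.2 (eval_ne_zero_of_finite hs hf (hct ζ h))
      nlinarith [norm_nonneg w, norm_nonneg (eval (c ζ) b)]
  have hw2 : 0 < 1 - ‖w‖ ^ 2 := by nlinarith [norm_nonneg w]
  have hgd : DiffContOnCl ℂ g (Metric.ball 0 1) := by
    refine DifferentiableOn.diffContOnCl fun ζ hζ => DifferentiableAt.differentiableWithinAt ?_
    rw [closure_ball _ one_ne_zero, mem_closedBall_zero_iff] at hζ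
    have hev := differentiableAt_eval (c := c) fun j => differentiableAt_diskAut (hz j) hζ
    exact ((hev _).add ((hev _).const_mul w)).div ((hev _).add ((hev _).const_mul w)) (hden ζ hζ)
  have hgle : ∀ ζ, ‖ζ‖ ≤ 1 → ‖g ζ‖ ≤ 1 := by
    intro ζ hζ
    refine Complex.norm_le_of_forall_mem_frontier_norm_le Metric.isBounded_ball hgd ?_
      (z := ζ) (by rwa [closure_ball _ one_ne_zero, mem_closedBall_zero_iff])
    intro ξ hξ
    rw [frontier_ball _ one_ne_zero, mem_sphere_zero_iff_norm] at hξ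
    rw [norm_div, div_le_one (norm_pos_iff.2 (hden ξ hξ.le))]
    refine le_of_sq_le_sq ?_ (norm_nonneg _)
    have := mul_nonneg (defect_nonneg hs (hct ξ hξ)) hw2.le
    linarith [hsq ξ hξ]
  have hg0 : g 0 = (eval z (reflect n b) + w * eval z (reflect n a)) /
      (eval z a + w * eval z b) := by
    have : c 0 = z := by funext j; simp [c, diskAut]
    simp only [g, this]
  have hden0 := hden 0 (by simp)
  have hc0 : c 0 = z := by funext j; simp [c, diskAut]
  rw [hc0] at hden0
  suffices ‖g 0‖ ≠ 1 by
    have h := lt_of_le_of_ne (hgle 0 (by simp)) this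
    rwa [hg0, norm_div, div_lt_one (norm_pos_iff.2 hden0)] at h
  intro h1
  have hconst := Complex.norm_eqOn_closedBall_of_isMaxOn hgd (z := 0) (r := 1)
    (fun ζ hζ => by
      simp only [Set.mem_ofPred_eq, Function.comp_apply, h1]
      exact hgle ζ (mem_ball_zero_iff.1 hζ).le)
  -- Injectivity of `c` is read off from one coordinate, which exists because `0 < m`.
  refine Set.infinite_of_injOn_mapsTo (f := c) ?_ ?_ infinite_norm_eq_one
    (finite_defect_eq_zero hf)
  · intro ζ hζ ζ' hζ' h
    exact diskAut_injOn (hz ⟨0, hm⟩) hζ hζ' (congrFun h ⟨0, hm⟩)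
  · intro ζ hζ
    have hζ' : ‖ζ‖ = 1 := hζ
    refine ⟨hct ζ hζ, ?_⟩
    have h2 := hconst (mem_closedBall_zero_iff.2 hζ'.le)
    simp only [Function.comp_apply, Function.const_apply, h1, g, norm_div] at h2
    rw [div_eq_one_iff_eq (norm_ne_zero_iff.2 (hden ζ hζ'.le))] at h2
    have h3 := hsq ζ hζ'
    rw [h2, sub_self] at h3
    exact (mul_eq_zero.1 h3.symm).resolve_right hw2.ne'

theorem norm_iterNum_lt (hm : 0 < m) (ha : ∀ j, a.degreeOf j ≤ n j)
    (hb : ∀ j, b.degreeOf j ≤ n j) (hs : IsStable (ofSlice a b))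
    (hf : {ζ ∈ torus (m + 1) | eval ζ (ofSlice a b) = 0}.Finite) (N : ℕ)
    {z : Fin (m + 1) → ℂ} (hz : z ∈ polydisk (m + 1)) :
    ‖eval z (iterNum n a b N)‖ < ‖eval z (iterDen n a b N)‖ := by
  induction N with
  | zero => simpa [iterNum_zero, iterDen_zero] using hz (Fin.last m)
  | succ N ih =>
    have h0 : eval z (iterDen n a b N) ≠ 0 := norm_pos_iff.1 ((norm_nonneg _).trans_lt ih)
    have hw : ‖eval z (iterNum n a b N) / eval z (iterDen n a b N)‖ < 1 := by
      rwa [norm_div, div_lt_one (norm_pos_iff.2 h0)]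
    have h := norm_reflect_slice_lt hm ha hb hs hf (mem_polydisk_castSucc hz) hw
    have h' := mul_lt_mul_of_pos_right h (norm_pos_iff.2 h0)
    have e : ∀ x y, (x + eval z (iterNum n a b N) / eval z (iterDen n a b N) * y) *
        eval z (iterDen n a b N) =
        x * eval z (iterDen n a b N) + y * eval z (iterNum n a b N) := fun x y => by
      rw [add_mul, mul_right_comm, div_mul_cancel₀ _ h0, mul_comm y]
    rwa [← norm_mul, ← norm_mul, e, e, ← eval_iterNum_succ, ← eval_iterDen_succ] at h'

theorem isStable_iterDen (hm : 0 < m) (ha : ∀ j, a.degreeOf j ≤ n j)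
    (hb : ∀ j, b.degreeOf j ≤ n j) (hs : IsStable (ofSlice a b))
    (hf : {ζ ∈ torus (m + 1) | eval ζ (ofSlice a b) = 0}.Finite) (N : ℕ) :
    IsStable (iterDen n a b N) := fun _ hz =>
  norm_pos_iff.1 ((norm_nonneg _).trans_lt (norm_iterNum_lt hm ha hb hs hf N hz))

/-! ### The iterates on the torus -/

/-- On the torus the defect is the determinant divided by a unimodular factor, so this is
multiplicativity of the determinant. -/
theorem defect_iter (ha : ∀ j, a.degreeOf j ≤ n j) (hb : ∀ j, b.degreeOf j ≤ n j) (N : ℕ)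
    {z : Fin m → ℂ} (hz : z ∈ torus m) :
    defect ((polyMatrix n a b ^ N) 1 1) ((polyMatrix n a b ^ N) 1 0) z = defect a b z ^ N := by
  induction N with
  | zero => simp [defect]
  | succ N ih =>
    obtain ⟨h0, h1⟩ := eval_polyMatrix_pow_of_mem_torus ha hb N hz
    have ht : ‖mon n z ^ N‖ = 1 := by rw [norm_pow, norm_mon n hz, one_pow]
    rw [pow_succ (defect a b z), ← ih]
    simp only [defect, polyMatrix_pow_succ_one, map_add, map_mul, h0, h1]
    generalize mon n z ^ N = t at *
    generalize eval z ((polyMatrix n a b ^ N) 1 1) = u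
    generalize eval z ((polyMatrix n a b ^ N) 1 0) = v
    generalize eval z a = x
    generalize eval z b = y
    have ht2 : t.re * t.re + t.im * t.im = 1 := by
      rw [← Complex.normSq_apply, Complex.normSq_eq_norm_sq, ht, one_pow]
    simp only [← Complex.normSq_eq_norm_sq, Complex.normSq_apply, Complex.add_re, Complex.add_im,
      Complex.mul_re, Complex.mul_im, Complex.conj_re, Complex.conj_im]
    linear_combination (y.re * y.re + y.im * y.im) * ((v.re * v.re + v.im * v.im) -
      (u.re * u.re + u.im * u.im)) * ht2

end RIF

end

noncomputable section

namespace RIF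

/-! ### The Poisson kernel on a fibre -/

/-- The Poisson-type kernel `(|u|² - |v|²) / |u + e^{it} v|²`. -/
def fibreKernel (u v : ℂ) (t : ℝ) : ℝ :=
  (‖u‖ ^ 2 - ‖v‖ ^ 2) / ‖u + Complex.exp (t * Complex.I) * v‖ ^ 2

section Fibre

variable {u v : ℂ}

theorem norm_sub_norm_le_norm_fibre (u v : ℂ) (t : ℝ) :
    ‖u‖ - ‖v‖ ≤ ‖u + Complex.exp (t * Complex.I) * v‖ := by
  have h := norm_sub_norm_le u (-(Complex.exp (t * Complex.I) * v))
  rwa [norm_neg, norm_mul, Complex.norm_exp_ofReal_mul_I, one_mul, sub_neg_eq_add] at h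

theorem fibreKernel_nonneg (h : ‖v‖ ≤ ‖u‖) (t : ℝ) : 0 ≤ fibreKernel u v t :=
  div_nonneg (sub_nonneg.2 (pow_le_pow_left₀ (norm_nonneg _) h 2)) (sq_nonneg _)

theorem continuous_fibreKernel (h : ‖v‖ < ‖u‖) : Continuous (fibreKernel u v) := by
  unfold fibreKernel
  refine Continuous.div (by fun_prop) (by fun_prop) fun t => ?_
  have := norm_sub_norm_le_norm_fibre u v t
  have : 0 < ‖u + Complex.exp (t * Complex.I) * v‖ := by linarith
  positivity

theorem fibreKernel_le (h : ‖v‖ < ‖u‖) (t : ℝ) :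
    fibreKernel u v t ≤ (‖u‖ + ‖v‖) ^ 2 / (‖u‖ ^ 2 - ‖v‖ ^ 2) := by
  have h1 : 0 < ‖u‖ - ‖v‖ := sub_pos.2 h
  have h2 : 0 < ‖u‖ + ‖v‖ := by linarith [norm_nonneg v]
  have h3 := norm_sub_norm_le_norm_fibre u v t
  have h4 : ‖u‖ ^ 2 - ‖v‖ ^ 2 = (‖u‖ + ‖v‖) * (‖u‖ - ‖v‖) := by ring
  calc fibreKernel u v t ≤ (‖u‖ ^ 2 - ‖v‖ ^ 2) / (‖u‖ - ‖v‖) ^ 2 := by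
        unfold fibreKernel
        gcongr
        rw [h4]; positivity
    _ = _ := by rw [h4]; field_simp

/-- The kernel is the real part of `(u - w v)/(u + w v)` at `w = e^{it}`, which is holomorphic on
the closed disk with value one at the centre; apply the mean value property. -/
theorem integral_fibreKernel (h : ‖v‖ < ‖u‖) :
    ∫ t in -Real.pi..Real.pi, fibreKernel u v t = 2 * Real.pi := by
  have hden : ∀ w : ℂ, ‖w‖ ≤ 1 → u + w * v ≠ 0 := by
    intro w hw h0
    have h1 : ‖u‖ = ‖w‖ * ‖v‖ := by
      rw [eq_neg_of_add_eq_zero_left h0, norm_neg, norm_mul]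
    nlinarith [norm_nonneg w, norm_nonneg v]
  let f : ℂ → ℂ := fun w => (u - w * v) / (u + w * v)
  have hf : DifferentiableOn ℂ f (Metric.closedBall 0 1) := by
    intro w hw
    refine DifferentiableAt.differentiableWithinAt ?_
    exact DifferentiableAt.div (by fun_prop) (by fun_prop) (hden w (mem_closedBall_zero_iff.1 hw))
  have hfd : DiffContOnCl ℂ f (Metric.ball 0 |1|) := by
    refine DifferentiableOn.diffContOnCl ?_
    rwa [abs_one, closure_ball _ one_ne_zero]
  have hav := hfd.circleAverage
  have hre := Complex.reCLM.circleAverage_comp_comm (f := f) (c := 0) (R := 1)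
    ((hf.continuousOn.mono Metric.sphere_subset_closedBall).circleIntegrable zero_le_one)
  have hu : u ≠ 0 := by simpa using hden 0 (by simp)
  have hf0 : f 0 = 1 := by simp [f, hu]
  rw [hav, hf0, Real.circleAverage_def] at hre
  have hk : ∀ t : ℝ, (Complex.reCLM ∘ f) (circleMap 0 1 t) = fibreKernel u v t := by
    intro t
    have hw : ‖Complex.exp (t * Complex.I)‖ ^ 2 = 1 := by
      rw [Complex.norm_exp_ofReal_mul_I, one_pow]
    simp only [Function.comp_apply, circleMap, zero_add, Complex.ofReal_one, one_mul, f,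
      Complex.reCLM_apply, fibreKernel, Complex.div_re]
    generalize Complex.exp (t * Complex.I) = w at hw
    rw [← add_div, Complex.normSq_eq_norm_sq]
    congr 1
    simp only [← Complex.normSq_eq_norm_sq, Complex.normSq_apply, Complex.add_re, Complex.add_im,
      Complex.mul_re, Complex.mul_im, Complex.sub_re, Complex.sub_im] at hw ⊢
    linear_combination (-(v.re * v.re + v.im * v.im)) * hw
  simp only [hk, smul_eq_mul, Complex.reCLM_apply, Complex.one_re] at hre
  have hper : Function.Periodic (fibreKernel u v) (2 * Real.pi) := by
    intro t
    have : Complex.exp ((t + 2 * Real.pi : ℝ) * Complex.I) = Complex.exp (t * Complex.I) := by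
      push_cast
      rw [add_mul]
      exact Complex.exp_periodic _
    simp only [fibreKernel, this]
  have h2 := hper.intervalIntegral_add_eq (-Real.pi) 0
  rw [show -Real.pi + 2 * Real.pi = Real.pi by ring, zero_add] at h2
  rw [h2]
  have := Real.pi_pos
  field_simp at hre
  linarith

/-- One factor of the kernel integrates to `2π`; the remaining power `s` is bounded by its supremum.
-/
theorem lintegral_fibreKernel_rpow_le {s : ℝ} (hs : 0 ≤ s) (h : ‖v‖ < ‖u‖) {K : ℝ}
    (hK : ‖u‖ + ‖v‖ ≤ K) {T : Set ℝ} (hT : T ⊆ Set.Ioc (-Real.pi) Real.pi) :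
    ∫⁻ t in T, ENNReal.ofReal (fibreKernel u v t ^ (1 + s)) ≤
      ENNReal.ofReal ((K ^ 2) ^ s * (2 * Real.pi)) *
        ENNReal.ofReal ((‖u‖ ^ 2 - ‖v‖ ^ 2) ^ (-s)) := by
  have hD : 0 < ‖u‖ ^ 2 - ‖v‖ ^ 2 :=
    sub_pos.2 (pow_lt_pow_left₀ h (norm_nonneg _) two_ne_zero)
  have hP := fibreKernel_nonneg h.le
  have hpi := Real.pi_pos
  have hpt : ∀ t, fibreKernel u v t ^ (1 + s) ≤
      ((K ^ 2) ^ s * (‖u‖ ^ 2 - ‖v‖ ^ 2) ^ (-s)) * fibreKernel u v t := by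
    intro t
    rw [Real.rpow_add' (hP t) (by linarith), Real.rpow_one, mul_comm]
    refine mul_le_mul_of_nonneg_right ?_ (hP t)
    calc fibreKernel u v t ^ s ≤ (K ^ 2 / (‖u‖ ^ 2 - ‖v‖ ^ 2)) ^ s := by
          refine Real.rpow_le_rpow (hP t) ((fibreKernel_le h t).trans ?_) hs
          gcongr
      _ = _ := by
          rw [Real.div_rpow (sq_nonneg _) hD.le, Real.rpow_neg hD.le, div_eq_mul_inv]
  have hint : ∫⁻ t in Set.Ioc (-Real.pi) Real.pi, ENNReal.ofReal (fibreKernel u v t) =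
      ENNReal.ofReal (2 * Real.pi) := by
    rw [← integral_fibreKernel h, intervalIntegral.integral_of_le (by linarith),
      ofReal_integral_eq_lintegral_ofReal
        (((continuous_fibreKernel h).intervalIntegrable _ _).1) (ae_of_all _ hP)]
  calc ∫⁻ t in T, ENNReal.ofReal (fibreKernel u v t ^ (1 + s))
      ≤ ∫⁻ t in Set.Ioc (-Real.pi) Real.pi,
          ENNReal.ofReal ((K ^ 2) ^ s * (‖u‖ ^ 2 - ‖v‖ ^ 2) ^ (-s)) *
            ENNReal.ofReal (fibreKernel u v t) := by
        refine (lintegral_mono_set hT).trans (lintegral_mono fun t => ?_)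
        rw [← ENNReal.ofReal_mul (by positivity)]
        exact ENNReal.ofReal_le_ofReal (hpt t)
    _ = _ := by
        rw [lintegral_const_mul' _ _ ENNReal.ofReal_ne_top, hint,
          ← ENNReal.ofReal_mul (by positivity), ← ENNReal.ofReal_mul (by positivity)]
        congr 1
        ring

/-- At the peak `τ = -arg(-v/u)` the vector `e^{iτ} v` points opposite to `u`, and the norm is
exactly `‖u‖ - ‖v‖`. Moving the angle to `t` costs at most `‖v‖ |t - τ|`. -/
theorem norm_fibre_le (hu : u ≠ 0) (hvu : ‖v‖ ≤ ‖u‖) (t : ℝ) :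
    ‖u + Complex.exp (t * Complex.I) * v‖ ≤
      ‖u‖ - ‖v‖ + ‖u‖ * |t - -(-v / u).arg| := by
  set τ := -(-v / u).arg with hτ
  have hw : v = -(u * ((‖v‖ / ‖u‖ : ℝ) * Complex.exp (-τ * Complex.I))) := by
    have h := Complex.norm_mul_exp_arg_mul_I (-v / u)
    rw [norm_div, norm_neg] at h
    rw [hτ, Complex.ofReal_neg, neg_neg, h]
    field_simp
  have he : u + Complex.exp (t * Complex.I) * v =
      u * (1 - (‖v‖ / ‖u‖ : ℝ)) -
        u * ((‖v‖ / ‖u‖ : ℝ) * (Complex.exp (Complex.I * (t - τ : ℝ)) - 1)) := by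
    conv_lhs => rw [hw]
    have : Complex.exp (Complex.I * (t - τ : ℝ)) =
        Complex.exp (t * Complex.I) * Complex.exp (-τ * Complex.I) := by
      rw [← Complex.exp_add]; congr 1; push_cast; ring
    rw [this]
    ring
  have hu0 := norm_pos_iff.2 hu
  have hρ : ‖v‖ / ‖u‖ ≤ 1 := (div_le_one hu0).2 hvu
  have h1 : ‖u * (1 - (‖v‖ / ‖u‖ : ℝ))‖ = ‖u‖ - ‖v‖ := by
    rw [norm_mul, ← Complex.ofReal_one, ← Complex.ofReal_sub, Complex.norm_real,
      Real.norm_of_nonneg (by linarith)]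
    field_simp
  have h2 : ‖u * ((‖v‖ / ‖u‖ : ℝ) * (Complex.exp (Complex.I * (t - τ : ℝ)) - 1))‖ ≤
      ‖u‖ * |t - τ| := by
    rw [norm_mul, norm_mul, Complex.norm_real, Real.norm_of_nonneg (by positivity)]
    have := Real.norm_exp_I_mul_ofReal_sub_one_le (x := t - τ)
    rw [Real.norm_eq_abs] at this
    refine mul_le_mul_of_nonneg_left ?_ hu0.le
    calc _ ≤ 1 * |t - τ| := mul_le_mul hρ this (norm_nonneg _) zero_le_one
      _ = _ := one_mul _
  rw [he]
  exact (norm_sub_le _ _).trans (by rw [h1]; linarith)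

/-- Write `D = ‖u‖² - ‖v‖²`. Within `D` of the peak the denominator is at most `(K D)²`, so the
kernel is at least `1/(K² D)`; the length `D` of the interval absorbs one power. -/
theorem le_lintegral_fibreKernel_rpow {s : ℝ} (hs : 0 ≤ s) (h : ‖v‖ < ‖u‖) {K : ℝ}
    (hK : 1 / ‖u‖ + ‖u‖ ≤ K) {T : Set ℝ}
    (hT : Set.Ioo (-(-v / u).arg) (-(-v / u).arg + (‖u‖ ^ 2 - ‖v‖ ^ 2)) ⊆ T) :
    ENNReal.ofReal (((K ^ 2) ^ (1 + s))⁻¹) * ENNReal.ofReal ((‖u‖ ^ 2 - ‖v‖ ^ 2) ^ (-s)) ≤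
      ∫⁻ t in T, ENNReal.ofReal (fibreKernel u v t ^ (1 + s)) := by
  have hu0 : 0 < ‖u‖ := (norm_nonneg _).trans_lt h
  set D := ‖u‖ ^ 2 - ‖v‖ ^ 2 with hDdef
  have hD : 0 < D := sub_pos.2 (pow_lt_pow_left₀ h (norm_nonneg _) two_ne_zero)
  have hK0 : 0 < K := lt_of_lt_of_le (by positivity) hK
  set τ := -(-v / u).arg
  have hpt : ∀ t ∈ Set.Ioo τ (τ + D),
      ((K ^ 2) ^ (1 + s))⁻¹ * D ^ (-(1 + s)) ≤ fibreKernel u v t ^ (1 + s) := by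
    intro t ht
    have h1 := norm_fibre_le (norm_pos_iff.1 hu0) h.le t
    have h2 : |t - τ| ≤ D := abs_le.2 ⟨by linarith [ht.1], by linarith [ht.2]⟩
    -- Since `‖u‖ - ‖v‖ = D / (‖u‖ + ‖v‖)`.
    have h3 : ‖u‖ - ‖v‖ ≤ 1 / ‖u‖ * D := by
      rw [hDdef, div_mul_eq_mul_div, one_mul, le_div_iff₀ hu0]
      nlinarith [norm_nonneg v]
    have h4 : ‖u + Complex.exp (t * Complex.I) * v‖ ≤ K * D := by
      calc _ ≤ _ := h1
        _ ≤ 1 / ‖u‖ * D + ‖u‖ * D := add_le_add h3 (mul_le_mul_of_nonneg_left h2 hu0.le)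
        _ = (1 / ‖u‖ + ‖u‖) * D := by ring
        _ ≤ _ := mul_le_mul_of_nonneg_right hK hD.le
    have h5 : 0 < ‖u + Complex.exp (t * Complex.I) * v‖ := by
      have := norm_sub_norm_le_norm_fibre u v t
      linarith
    have h6 : (K ^ 2 * D)⁻¹ ≤ fibreKernel u v t := by
      calc (K ^ 2 * D)⁻¹ = D / (K * D) ^ 2 := by field_simp
        _ ≤ _ := by unfold fibreKernel; gcongr
    calc _ = ((K ^ 2 * D)⁻¹) ^ (1 + s) := by
          rw [Real.inv_rpow (by positivity), Real.mul_rpow (by positivity) hD.le,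
            Real.rpow_neg hD.le, mul_inv]
      _ ≤ _ := Real.rpow_le_rpow (by positivity) h6 (by linarith)
  calc _ = ∫⁻ t in Set.Ioo τ (τ + D),
        ENNReal.ofReal (((K ^ 2) ^ (1 + s))⁻¹ * D ^ (-(1 + s))) := by
        rw [lintegral_const, Measure.restrict_apply_univ, Real.volume_Ioo, add_sub_cancel_left,
          ← ENNReal.ofReal_mul (by positivity), ← ENNReal.ofReal_mul (by positivity), mul_assoc]
        congr 2
        rw [show -s = -(1 + s) + 1 by ring, Real.rpow_add hD, Real.rpow_one]
    _ ≤ ∫⁻ t in Set.Ioo τ (τ + D), ENNReal.ofReal (fibreKernel u v t ^ (1 + s)) :=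
        setLIntegral_mono' measurableSet_Ioo fun t ht => ENNReal.ofReal_le_ofReal (hpt t ht)
    _ ≤ _ := lintegral_mono_set hT

end Fibre

end RIF

end

noncomputable section

namespace RIF

variable {m : ℕ}

/-! ### Integrability of a kernel on the product of a base and a fibre -/

theorem measurePreserving_last_castSucc (m : ℕ) :
    MeasurePreserving
      (fun θ : Fin (m + 1) → ℝ => (θ (Fin.last m), fun j : Fin m => θ (Fin.castSucc j)))
      volume (volume.prod volume) := by
  convert! volume_preserving_piFinSuccAbove (fun _ : Fin (m + 1) => ℝ) (Fin.last m) using 1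
  funext θ
  simp [MeasurableEquiv.piFinSuccAbove, Fin.insertNthEquiv]
  rfl

theorem ball_eq_preimage_last_castSucc {ε : ℝ} (hε : 0 < ε) :
    Metric.ball (0 : Fin (m + 1) → ℝ) ε =
      (fun θ : Fin (m + 1) → ℝ => (θ (Fin.last m), fun j : Fin m => θ (Fin.castSucc j))) ⁻¹'
        (Metric.ball 0 ε ×ˢ Metric.ball 0 ε) := by
  ext θ
  simp [pi_norm_lt_iff hε, Fin.forall_fin_succ', and_comm]

theorem setLIntegral_ball_last_castSucc {ε : ℝ} (hε : 0 < ε) {Φ : ℝ × (Fin m → ℝ) → ENNReal}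
    (hΦ : Measurable Φ) :
    ∫⁻ θ in Metric.ball (0 : Fin (m + 1) → ℝ) ε,
        Φ (θ (Fin.last m), fun j => θ (Fin.castSucc j)) =
      ∫⁻ x in Metric.ball (0 : Fin m → ℝ) ε, ∫⁻ t in Metric.ball (0 : ℝ) ε, Φ (t, x) := by
  rw [ball_eq_preimage_last_castSucc hε, (measurePreserving_last_castSucc m).setLIntegral_comp_preimage
    (Metric.isOpen_ball.measurableSet.prod Metric.isOpen_ball.measurableSet) hΦ,
    ← Measure.prod_restrict, lintegral_prod_symm _ hΦ.aemeasurable]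

theorem ae_castSucc_ne_zero (hm : 0 < m) :
    ∀ᵐ θ : Fin (m + 1) → ℝ, (fun j : Fin m => θ (Fin.castSucc j)) ≠ 0 := by
  have : Nonempty (Fin m) := ⟨⟨0, hm⟩⟩
  have h : ∀ᵐ x : Fin m → ℝ, x ≠ 0 := by
    rw [ae_iff]
    simp
  have h2 := (Measure.quasiMeasurePreserving_snd
    (μ := (volume : Measure ℝ)) (ν := (volume : Measure (Fin m → ℝ)))).ae h
  exact (measurePreserving_last_castSucc m).quasiMeasurePreserving.ae h2

section Kernel

variable {A B h : (Fin m → ℝ) → ℂ} {g : (Fin (m + 1) → ℝ) → ℂ} {s δ ε : ℝ}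

theorem measurable_fibreKernel_rpow (hA : Continuous A) (hB : Continuous B) (s : ℝ) :
    Measurable fun x : ℝ × (Fin m → ℝ) =>
      ENNReal.ofReal (fibreKernel (A x.2) (B x.2) x.1 ^ (1 + s)) := by
  have := hA.measurable
  have := hB.measurable
  unfold fibreKernel
  fun_prop

theorem memLp_ball_iff (hm : 0 < m) (hA : Continuous A) (hB : Continuous B) (hh : Continuous h)
    (hD : ∀ x, ‖x‖ < δ → x ≠ 0 → ‖B x‖ < ‖A x‖)
    (hnh : ∀ x, ‖h x‖ = ‖A x‖ ^ 2 - ‖B x‖ ^ 2)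
    (hg : ∀ θ : Fin (m + 1) → ℝ,
      ‖B (fun j => θ (Fin.castSucc j))‖ < ‖A (fun j => θ (Fin.castSucc j))‖ →
        g θ = h (fun j => θ (Fin.castSucc j)) / (A (fun j => θ (Fin.castSucc j)) +
          Complex.exp (θ (Fin.last m) * Complex.I) * B (fun j => θ (Fin.castSucc j))) ^ 2)
    (hs : 0 ≤ s) (hε : 0 < ε) (hεδ : ε ≤ δ) :
    MemLp g (ENNReal.ofReal (1 + s)) (volume.restrict (Metric.ball 0 ε)) ↔
      ∫⁻ x in Metric.ball (0 : Fin m → ℝ) ε, ∫⁻ t in Metric.ball (0 : ℝ) ε,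
        ENNReal.ofReal (fibreKernel (A x) (B x) t ^ (1 + s)) < ⊤ := by
  let G : (Fin (m + 1) → ℝ) → ℂ := fun θ =>
    h (fun j => θ (Fin.castSucc j)) / (A (fun j => θ (Fin.castSucc j)) +
      Complex.exp (θ (Fin.last m) * Complex.I) * B (fun j => θ (Fin.castSucc j))) ^ 2
  have hGm : Measurable G := by
    have := hA.measurable
    have := hB.measurable
    have := hh.measurable
    fun_prop
  have hgG : g =ᵐ[volume.restrict (Metric.ball 0 ε)] G := by
    filter_upwards [ae_restrict_of_ae (ae_castSucc_ne_zero hm),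
      ae_restrict_mem Metric.isOpen_ball.measurableSet] with θ h0 hθ
    refine hg θ (hD _ ?_ h0)
    rw [ball_eq_preimage_last_castSucc hε] at hθ
    exact (mem_ball_zero_iff.1 hθ.2).trans_le hεδ
  have hp0 : ENNReal.ofReal (1 + s) ≠ 0 := (ENNReal.ofReal_pos.2 (by linarith)).ne'
  rw [memLp_congr_ae hgG, MemLp, and_iff_right hGm.aestronglyMeasurable,
    eLpNorm_lt_top_iff_lintegral_rpow_enorm_lt_top hp0 ENNReal.ofReal_ne_top,
    ENNReal.toReal_ofReal (by linarith),
    ← setLIntegral_ball_last_castSucc hε (measurable_fibreKernel_rpow hA hB s)]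
  refine iff_of_eq (congrArg (· < ⊤) (lintegral_congr fun θ => ?_))
  rw [← ofReal_norm, ENNReal.ofReal_rpow_of_nonneg (norm_nonneg _) (by linarith)]
  simp only [G, fibreKernel, norm_div, norm_pow, hnh]

/-- Tonelli reduces the norm to fibre integrals, to which the two kernel bounds apply. The
hypotheses at `0` matter for the forward direction: they place the peak over `x = 0` at angle `0`.
-/
theorem memLp_iff_lintegral_rpow (hm : 0 < m) (hA : Continuous A) (hB : Continuous B)
    (hh : Continuous h) (hδ : 0 < δ) (hD : ∀ x, ‖x‖ < δ → x ≠ 0 → ‖B x‖ < ‖A x‖)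
    (hnh : ∀ x, ‖h x‖ = ‖A x‖ ^ 2 - ‖B x‖ ^ 2)
    (hg : ∀ θ : Fin (m + 1) → ℝ,
      ‖B (fun j => θ (Fin.castSucc j))‖ < ‖A (fun j => θ (Fin.castSucc j))‖ →
        g θ = h (fun j => θ (Fin.castSucc j)) / (A (fun j => θ (Fin.castSucc j)) +
          Complex.exp (θ (Fin.last m) * Complex.I) * B (fun j => θ (Fin.castSucc j))) ^ 2)
    (hA0 : A 0 ≠ 0) (hAB : A 0 + B 0 = 0) (hs : 0 ≤ s) :
    (∃ U ∈ 𝓝 (0 : Fin (m + 1) → ℝ),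
        MemLp g (ENNReal.ofReal (1 + s)) (volume.restrict U)) ↔
      ∃ V ∈ 𝓝 (0 : Fin m → ℝ),
        ∫⁻ x in V, ENNReal.ofReal ((‖A x‖ ^ 2 - ‖B x‖ ^ 2) ^ (-s)) < ⊤ := by
  have : Nonempty (Fin m) := ⟨⟨0, hm⟩⟩
  have hne : ∀ᵐ x : Fin m → ℝ, x ≠ 0 := by
    rw [ae_iff]
    simp
  constructor
  · rintro ⟨U, hU, hgU⟩
    obtain ⟨ε₀, hε₀, hεU⟩ := Metric.mem_nhds_iff.1 hU
    let ε := min ε₀ δ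
    have hε : 0 < ε := lt_min hε₀ hδ
    have hfin := (memLp_ball_iff hm hA hB hh hD hnh hg hs hε (min_le_right _ _)).1
      (hgU.mono_measure (Measure.restrict_mono
        ((Metric.ball_subset_ball (min_le_left _ _)).trans hεU) le_rfl))
    let K : ℝ := 1 / ‖A 0‖ + ‖A 0‖ + 1
    have hBA : -B 0 / A 0 = 1 := by
      rw [eq_neg_of_add_eq_zero_right hAB, neg_neg, div_self hA0]
    have hK : ∀ᶠ x in 𝓝 0, 1 / ‖A x‖ + ‖A x‖ < K := by
      have : ContinuousAt (fun x => 1 / ‖A x‖ + ‖A x‖) 0 :=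
        (continuousAt_const.div hA.continuousAt.norm (norm_ne_zero_iff.2 hA0)).add
          hA.continuousAt.norm
      exact this.eventually_lt_const (lt_add_one _)
    have harg : ContinuousAt (fun x => (-B x / A x).arg) 0 := by
      refine ContinuousAt.comp (f := fun x => -B x / A x) (g := Complex.arg)
        (Complex.continuousAt_arg ?_) (hB.continuousAt.neg.div hA.continuousAt hA0)
      simp only [hBA]
      exact Complex.one_mem_slitPlane
    have harg0 : (-B 0 / A 0).arg = 0 := by rw [hBA, Complex.arg_one]
    have hD0 : ‖A 0‖ ^ 2 - ‖B 0‖ ^ 2 = 0 := by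
      rw [eq_neg_of_add_eq_zero_left hAB, norm_neg, sub_self]
    have hτ1 : ∀ᶠ x in 𝓝 0, -ε < -(-B x / A x).arg := by
      refine harg.neg.eventually_const_lt ?_
      simpa [harg0] using hε
    have hτ2 : ∀ᶠ x in 𝓝 0, -(-B x / A x).arg + (‖A x‖ ^ 2 - ‖B x‖ ^ 2) < ε := by
      have : ContinuousAt (fun x => -(-B x / A x).arg + (‖A x‖ ^ 2 - ‖B x‖ ^ 2)) 0 :=
        harg.neg.add ((hA.continuousAt.norm.pow 2).sub (hB.continuousAt.norm.pow 2))
      refine this.eventually_lt_const ?_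
      simpa only [harg0, hD0, neg_zero, add_zero] using hε
    -- Over `V` the whole interval next to the peak lies in the fibre `(-ε, ε)`, and `K` is a
    -- uniform constant.
    let V := {x | (1 / ‖A x‖ + ‖A x‖ < K ∧ -ε < -(-B x / A x).arg ∧
      -(-B x / A x).arg + (‖A x‖ ^ 2 - ‖B x‖ ^ 2) < ε)}
    have hVn : V ∈ 𝓝 0 := hK.and (hτ1.and hτ2)
    obtain ⟨r₀, hr₀, hrV⟩ := Metric.mem_nhds_iff.1 hVn
    let r := min r₀ ε
    have hr : 0 < r := lt_min hr₀ hε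
    have hK0 : 0 < K := by positivity
    let c := ENNReal.ofReal (((K ^ 2) ^ (1 + s))⁻¹)
    have hc0 : c ≠ 0 := (ENNReal.ofReal_pos.2 (by positivity)).ne'
    refine ⟨Metric.ball 0 r, Metric.ball_mem_nhds _ hr, ?_⟩
    have hle : c * ∫⁻ x in Metric.ball (0 : Fin m → ℝ) r,
        ENNReal.ofReal ((‖A x‖ ^ 2 - ‖B x‖ ^ 2) ^ (-s)) < ⊤ := by
      rw [← lintegral_const_mul' _ _ ENNReal.ofReal_ne_top]
      refine lt_of_le_of_lt ?_ hfin
      refine le_trans (lintegral_mono_ae ?_)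
        (lintegral_mono_set (Metric.ball_subset_ball (min_le_right r₀ ε)))
      filter_upwards [ae_restrict_of_ae hne,
        ae_restrict_mem Metric.isOpen_ball.measurableSet] with x hx0 hx
      obtain ⟨h1, h2, h3⟩ := hrV (Metric.ball_subset_ball (min_le_left _ _) hx)
      have hxδ : ‖x‖ < δ := (mem_ball_zero_iff.1 hx).trans_le
        ((min_le_right _ _).trans (min_le_right _ _))
      refine le_lintegral_fibreKernel_rpow hs (hD x hxδ hx0) h1.le ?_
      rw [Real.ball_eq_Ioo]
      exact Set.Ioo_subset_Ioo (by linarith) (by linarith)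
    exact (ENNReal.mul_lt_top_iff.1 hle).elim (fun h => h.2)
      fun h => h.elim (fun h => absurd h hc0) fun h => h ▸ ENNReal.zero_lt_top
  · rintro ⟨V, hV, hfin⟩
    let K : ℝ := ‖A 0‖ + ‖B 0‖ + 1
    have hK : ∀ᶠ x in 𝓝 0, ‖A x‖ + ‖B x‖ < K :=
      (hA.continuousAt.norm.add hB.continuousAt.norm).eventually_lt_const (lt_add_one _)
    obtain ⟨ε₀, hε₀, hεV⟩ := Metric.mem_nhds_iff.1 (inter_mem hV hK)
    -- The cap at `π` keeps the fibre within one period of the kernel.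
    let ε := min (min ε₀ δ) Real.pi
    have hε : 0 < ε := lt_min (lt_min hε₀ hδ) Real.pi_pos
    have hεδ : ε ≤ δ := (min_le_left _ _).trans (min_le_right _ _)
    have hεε : ε ≤ ε₀ := (min_le_left _ _).trans (min_le_left _ _)
    refine ⟨Metric.ball 0 ε, Metric.ball_mem_nhds _ hε,
      (memLp_ball_iff hm hA hB hh hD hnh hg hs hε hεδ).2 ?_⟩
    calc _ ≤ ∫⁻ x in Metric.ball (0 : Fin m → ℝ) ε,
          ENNReal.ofReal ((K ^ 2) ^ s * (2 * Real.pi)) *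
            ENNReal.ofReal ((‖A x‖ ^ 2 - ‖B x‖ ^ 2) ^ (-s)) := by
          refine lintegral_mono_ae ?_
          filter_upwards [ae_restrict_of_ae hne,
            ae_restrict_mem Metric.isOpen_ball.measurableSet] with x hx0 hx
          have hxK := (hεV (Metric.ball_subset_ball hεε hx)).2
          refine lintegral_fibreKernel_rpow_le hs
            (hD x ((mem_ball_zero_iff.1 hx).trans_le hεδ) hx0) (le_of_lt hxK) ?_
          rw [Real.ball_eq_Ioo]
          refine Set.Ioo_subset_Ioc_self.trans (Set.Ioc_subset_Ioc ?_ ?_)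
          · linarith [min_le_right (min ε₀ δ) Real.pi]
          · linarith [min_le_right (min ε₀ δ) Real.pi]
      _ = ENNReal.ofReal ((K ^ 2) ^ s * (2 * Real.pi)) *
          ∫⁻ x in Metric.ball (0 : Fin m → ℝ) ε,
            ENNReal.ofReal ((‖A x‖ ^ 2 - ‖B x‖ ^ 2) ^ (-s)) :=
          lintegral_const_mul' _ _ ENNReal.ofReal_ne_top
      _ < ⊤ := ENNReal.mul_lt_top ENNReal.ofReal_lt_top
          ((lintegral_mono_set ((Metric.ball_subset_ball hεε).trans
            (hεV.trans Set.inter_subset_left))).trans_lt hfin)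

end Kernel

end RIF

end

noncomputable section

namespace RIF

open MvPolynomial

variable {m : ℕ} {n : Fin m → ℕ} {a b : MvPolynomial (Fin m) ℂ}

/-! ### The last-variable derivative of the iterates on the torus -/

theorem norm_lt_of_defect_pos {z : Fin m → ℂ} (h : 0 < defect a b z) :
    ‖eval z b‖ < ‖eval z a‖ :=
  lt_of_pow_lt_pow_left₀ 2 (norm_nonneg _) (sub_pos.1 h)

theorem eval_iterDen_ne_zero_of_defect_pos (ha : ∀ j, a.degreeOf j ≤ n j)
    (hb : ∀ j, b.degreeOf j ≤ n j) (N : ℕ) {z : Fin (m + 1) → ℂ} (hz : z ∈ torus (m + 1))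
    (hD : 0 < defect a b fun j => z j.castSucc) : eval z (iterDen n a b N) ≠ 0 := by
  have h := norm_lt_of_defect_pos
    ((defect_iter ha hb N (mem_torus_castSucc hz)).symm ▸ pow_pos hD N)
  rw [iterDen, eval_ofSlice]
  intro h0
  rw [eq_neg_of_add_eq_zero_left h0, norm_neg, norm_mul, hz, one_mul] at h
  exact lt_irrefl _ h

/-- The numerator in the quotient rule is the determinant of the matrix power, which on the torus is
`t^N` times the defect. -/
theorem derivLast_sliceIter (ha : ∀ j, a.degreeOf j ≤ n j) (hb : ∀ j, b.degreeOf j ≤ n j)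
    (N : ℕ) {z : Fin (m + 1) → ℂ} (hz : z ∈ torus (m + 1))
    (hD : 0 < defect a b fun j => z j.castSucc) :
    derivLast (sliceIter (quot (polydeg n) (ofSlice a b)) N) z =
      mon n (fun j => z j.castSucc) ^ N * ((defect ((polyMatrix n a b ^ N) 1 1)
        ((polyMatrix n a b ^ N) 1 0) (fun j => z j.castSucc) : ℝ) : ℂ) /
      (eval (fun j => z j.castSucc) ((polyMatrix n a b ^ N) 1 1) +
        z (Fin.last m) * eval (fun j => z j.castSucc) ((polyMatrix n a b ^ N) 1 0)) ^ 2 := by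
  have hup : ∀ u v w, eval (Function.update z (Fin.last m) w) (ofSlice u v) =
      eval (fun j => z j.castSucc) u + w * eval (fun j => z j.castSucc) v := fun u v w => by
    rw [eval_ofSlice, Function.update_self]
    simp only [Function.update_of_ne (Fin.castSucc_lt_last _).ne]
  -- The iterate agrees with the quotient only where the earlier denominators do not vanish;
  -- differentiating needs this on a neighbourhood.
  have hne : ∀ k, ∀ᶠ w in 𝓝 (z (Fin.last m)),
      eval (Function.update z (Fin.last m) w) (iterDen n a b k) ≠ 0 := fun k => by
    have hc : Continuous fun w => eval (Function.update z (Fin.last m) w) (iterDen n a b k) :=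
      (MvPolynomial.continuous_eval _).comp (continuous_const.update _ continuous_id)
    refine hc.continuousAt.eventually_ne ?_
    rw [Function.update_eq_self]
    exact eval_iterDen_ne_zero_of_defect_pos ha hb k hz hD
  obtain ⟨h0, h1⟩ := eval_polyMatrix_pow_of_mem_torus ha hb N (mem_torus_castSucc hz)
  have hden := (hne N).self_of_nhds
  rw [iterDen, hup] at hden
  have heq : (fun w => sliceIter (quot (polydeg n) (ofSlice a b)) N
      (Function.update z (Fin.last m) w)) =ᶠ[𝓝 (z (Fin.last m))] fun w =>
        (eval (fun j => z j.castSucc) ((polyMatrix n a b ^ N) 0 1) +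
          w * eval (fun j => z j.castSucc) ((polyMatrix n a b ^ N) 0 0)) /
        (eval (fun j => z j.castSucc) ((polyMatrix n a b ^ N) 1 1) +
          w * eval (fun j => z j.castSucc) ((polyMatrix n a b ^ N) 1 0)) := by
    filter_upwards [(Finset.eventually_all (Finset.range N)).2 fun k _ => hne k] with w hw
    rw [sliceIter_quot_eq ha hb fun k hk => hw k (Finset.mem_range.2 hk), iterNum, iterDen, hup,
      hup]
  have hlin : ∀ x y w : ℂ, HasDerivAt (fun w : ℂ => x + w * y) y w := fun x y w => by
    simpa using ((hasDerivAt_id w).mul_const y).const_add x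
  rw [derivLast, heq.deriv_eq, ((hlin _ _ _).fun_div (hlin _ _ _) hden).deriv]
  congr 1
  rw [h0, h1, defect, Complex.ofReal_sub, Complex.ofReal_pow, Complex.ofReal_pow,
    ← Complex.mul_conj', ← Complex.mul_conj']
  ring

theorem sliceIter_one (f : (Fin (m + 1) → ℂ) → ℂ) : sliceIter f 1 = f := by
  funext z
  simp [sliceIter]

/-! ### The local index -/

theorem torusMap_mem_torus {d : ℕ} (θ : Fin d → ℝ) : torusMap 0 1 θ ∈ torus d := fun j => by
  simp [torusMap, Complex.norm_exp_ofReal_mul_I]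

theorem torusMap_zero_one_zero {d : ℕ} :
    torusMap (0 : Fin d → ℂ) 1 0 = fun _ => 1 := by
  funext j
  simp [torusMap]

theorem continuous_torusMap {d : ℕ} (c : Fin d → ℂ) (R : Fin d → ℝ) :
    Continuous (torusMap c R) := by
  unfold torusMap
  fun_prop

theorem exists_defect_pos (hs : IsStable (ofSlice a b))
    (hf : {ζ ∈ torus (m + 1) | eval ζ (ofSlice a b) = 0}.Finite) :
    ∃ δ > 0, ∀ x : Fin m → ℝ, ‖x‖ < δ → x ≠ 0 → 0 < defect a b (torusMap 0 1 x) := by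
  let S := {z ∈ torus m | defect a b z = 0} \ {fun _ => (1 : ℂ)}
  have hS : Sᶜ ∈ 𝓝 (torusMap (0 : Fin m → ℂ) 1 0) := by
    rw [torusMap_zero_one_zero]
    exact (((finite_defect_eq_zero hf).subset Set.sdiff_subset).isClosed.isOpen_compl).mem_nhds
      fun h => h.2 rfl
  obtain ⟨δ, hδ, hδS⟩ := Metric.mem_nhds_iff.1 ((continuous_torusMap 0 1).continuousAt hS)
  -- With `‖x‖ < 1` each angle is recovered from its exponential by `arg`, so only `x = 0` maps to
  -- `(1,…,1)`.
  refine ⟨min δ 1, lt_min hδ one_pos, fun x hx hx0 => ?_⟩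
  refine lt_of_le_of_ne (defect_nonneg hs (torusMap_mem_torus x)) fun h0 => ?_
  have hxS : torusMap 0 1 x ∉ S :=
    hδS (mem_ball_zero_iff.2 (hx.trans_le (min_le_left _ _)))
  refine hxS ⟨⟨torusMap_mem_torus x, h0.symm⟩, fun h => hx0 ?_⟩
  funext j
  have hj : Complex.exp (x j * Complex.I) = 1 := by simpa [torusMap] using congrFun h j
  have hxj := (norm_le_pi_norm x j).trans_lt (hx.trans_le (min_le_right _ _))
  rw [Real.norm_eq_abs, abs_lt] at hxj
  have harg : (Complex.exp (x j * Complex.I)).arg = x j :=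
    Complex.arg_exp_mul_I (x j) ▸ (toIocMod_eq_self _).2
      ⟨by linarith [hxj.1, Real.pi_gt_three], by linarith [hxj.2, Real.pi_gt_three]⟩
  rw [← harg, hj, Complex.arg_one, Pi.zero_apply]

theorem memLpNearOne_derivLast_sliceIter_iff (hm : 0 < m) (ha : ∀ j, a.degreeOf j ≤ n j)
    (hb : ∀ j, b.degreeOf j ≤ n j) (hst : IsStable (ofSlice a b))
    (hf : {ζ ∈ torus (m + 1) | eval ζ (ofSlice a b) = 0}.Finite) (N : ℕ)
    (hA0 : eval (fun _ => (1 : ℂ)) ((polyMatrix n a b ^ N) 1 1) ≠ 0)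
    (hAB : eval (fun _ => (1 : ℂ)) ((polyMatrix n a b ^ N) 1 1) +
      eval (fun _ => (1 : ℂ)) ((polyMatrix n a b ^ N) 1 0) = 0) {s : ℝ} (hs : 0 ≤ s) :
    MemLpNearOne (derivLast (sliceIter (quot (polydeg n) (ofSlice a b)) N)) (1 + s) ↔
      ∃ V ∈ 𝓝 (0 : Fin m → ℝ),
        ∫⁻ x in V, ENNReal.ofReal (defect a b (torusMap 0 1 x) ^ (-(N * s))) < ⊤ := by
  let A : (Fin m → ℝ) → ℂ := fun x => eval (torusMap 0 1 x) ((polyMatrix n a b ^ N) 1 1)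
  let B : (Fin m → ℝ) → ℂ := fun x => eval (torusMap 0 1 x) ((polyMatrix n a b ^ N) 1 0)
  have hA : Continuous A := (MvPolynomial.continuous_eval _).comp (continuous_torusMap 0 1)
  have hB : Continuous B := (MvPolynomial.continuous_eval _).comp (continuous_torusMap 0 1)
  have hdef : ∀ x, ‖A x‖ ^ 2 - ‖B x‖ ^ 2 = defect a b (torusMap 0 1 x) ^ N := fun x =>
    defect_iter ha hb N (torusMap_mem_torus x)
  have hnn : ∀ x : Fin m → ℝ, 0 ≤ defect a b (torusMap 0 1 x) := fun x =>
    defect_nonneg hst (torusMap_mem_torus x)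
  let h : (Fin m → ℝ) → ℂ := fun x =>
    mon n (torusMap 0 1 x) ^ N * ((‖A x‖ ^ 2 - ‖B x‖ ^ 2 : ℝ) : ℂ)
  have hh : Continuous h := by
    have := continuous_torusMap (0 : Fin m → ℂ) 1
    unfold h mon
    fun_prop
  have hcs : ∀ θ : Fin (m + 1) → ℝ, (fun j : Fin m => torusMap (0 : Fin (m + 1) → ℂ) 1 θ
      (Fin.castSucc j)) = torusMap 0 1 fun j => θ (Fin.castSucc j) := fun θ => by
    funext j
    simp [torusMap]
  obtain ⟨δ, hδ, hpos⟩ := exists_defect_pos hst hf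
  have hlt : ∀ x : Fin m → ℝ, 0 < defect a b (torusMap 0 1 x) → ‖B x‖ < ‖A x‖ := fun x hx =>
    norm_lt_of_defect_pos ((defect_iter ha hb N (torusMap_mem_torus x)).symm ▸ pow_pos hx N)
  have hrw : ∀ x : Fin m → ℝ, (‖A x‖ ^ 2 - ‖B x‖ ^ 2) ^ (-s) =
      defect a b (torusMap 0 1 x) ^ (-(N * s)) := fun x => by
    rw [hdef, ← Real.rpow_natCast, ← Real.rpow_mul (hnn x), mul_neg]
  simp only [← hrw]
  rcases N.eq_zero_or_pos with rfl | hN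
  · simp at hAB
  refine memLp_iff_lintegral_rpow (h := h) hm hA hB hh hδ (fun x hx hx0 => hlt x (hpos x hx hx0))
    (fun x => ?_) (fun θ hθ => ?_) ?_ ?_ hs
  · rw [norm_mul, norm_pow, norm_mon n (torusMap_mem_torus x), one_pow, one_mul, Complex.norm_real,
      Real.norm_of_nonneg (by rw [hdef]; exact pow_nonneg (hnn x) N)]
  · have hD : 0 < defect a b (torusMap 0 1 fun j => θ (Fin.castSucc j)) := by
      refine lt_of_le_of_ne (hnn _) fun h0 => ?_
      have := hdef fun j => θ (Fin.castSucc j)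
      rw [← h0, zero_pow hN.ne'] at this
      nlinarith [norm_nonneg (B fun j => θ (Fin.castSucc j))]
    rw [derivLast_sliceIter ha hb N (torusMap_mem_torus θ) (by rwa [hcs]), hcs]
    simp [h, A, B, defect, torusMap]
  · simpa only [A, torusMap_zero_one_zero] using hA0
  · simpa only [A, B, torusMap_zero_one_zero] using hAB

/-- Both integrability conditions reduce to the same base integral, so `1 + s` is admissible for the
iterate exactly when `1 + N s` is for `φ`; the suprema scale accordingly. -/
theorem isLocalIndex_sliceIter (hm : 0 < m) (ha : ∀ j, a.degreeOf j ≤ n j)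
    (hb : ∀ j, b.degreeOf j ≤ n j) (hst : IsStable (ofSlice a b))
    (hf : {ζ ∈ torus (m + 1) | eval ζ (ofSlice a b) = 0}.Finite)
    (hsing : ∀ N, 1 ≤ N → eval (fun _ => (1 : ℂ)) ((polyMatrix n a b ^ N) 1 1) +
      eval (fun _ => (1 : ℂ)) ((polyMatrix n a b ^ N) 1 0) = 0) {N : ℕ} (hN : 1 ≤ N)
    (hA0 : eval (fun _ => (1 : ℂ)) ((polyMatrix n a b ^ N) 1 1) ≠ 0) {q : ℝ}
    (hq : IsLocalIndex (quot (polydeg n) (ofSlice a b)) (1 + q)) :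
    IsLocalIndex (sliceIter (quot (polydeg n) (ofSlice a b)) N) (1 + q / N) := by
  have hN0 : (0 : ℝ) < N := by exact_mod_cast hN
  have h1 : eval (fun _ => (1 : ℂ)) ((polyMatrix n a b ^ 1) 1 1) ≠ 0 := by
    simpa [polyMatrix] using eval_ne_zero_of_finite hst hf (z := fun _ => 1) fun _ => by simp
  have key : ∀ s : ℝ, 0 ≤ s →
      (MemLpNearOne (derivLast (sliceIter (quot (polydeg n) (ofSlice a b)) N)) (1 + s) ↔
        MemLpNearOne (derivLast (quot (polydeg n) (ofSlice a b))) (1 + N * s)) := by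
    intro s hs
    have h2 := memLpNearOne_derivLast_sliceIter_iff hm ha hb hst hf 1 h1 (hsing 1 le_rfl)
      (mul_nonneg hN0.le hs)
    rw [sliceIter_one, Nat.cast_one, one_mul] at h2
    rw [h2, memLpNearOne_derivLast_sliceIter_iff hm ha hb hst hf N hA0 (hsing N hN) hs]
  constructor
  · rintro t ⟨ht1, ht⟩
    have h2 := (key (t - 1) (sub_nonneg.2 ht1)).1 (by rwa [add_sub_cancel])
    have h3 := hq.1 ⟨le_add_of_nonneg_right (mul_nonneg hN0.le (sub_nonneg.2 ht1)), h2⟩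
    have h4 : t - 1 ≤ q / N := by rw [le_div_iff₀ hN0]; linarith
    linarith
  · intro c hc
    have h5 : 1 + q ≤ 1 + N * (c - 1) := by
      refine hq.2 ?_
      rintro t ⟨ht1, ht⟩
      have hs : 0 ≤ (t - 1) / N := div_nonneg (sub_nonneg.2 ht1) hN0.le
      have h2 := (key _ hs).2 (by rwa [mul_div_cancel₀ _ hN0.ne', add_sub_cancel])
      have h3 := hc ⟨le_add_of_nonneg_right hs, h2⟩
      have h4 : (t - 1) / N ≤ c - 1 := by linarith
      rw [div_le_iff₀ hN0] at h4
      linarith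
    have h6 : q / N ≤ c - 1 := by rw [div_le_iff₀ hN0]; linarith
    linarith

/-! ### The value of the slice matrix at the singularity -/

theorem one_mem_torus (d : ℕ) : (fun _ => (1 : ℂ)) ∈ torus d := fun _ => by simp

/-- Both row sums of `M(1)` vanish, so `M(1)`, and with it `M(1)^(N-1) M(1)`, kills the vector `(1,
1)`. -/
theorem eval_one_polyMatrix_pow_row (ha : ∀ j, a.degreeOf j ≤ n j) (hb : ∀ j, b.degreeOf j ≤ n j)
    (hab : eval (fun _ => (1 : ℂ)) a + eval (fun _ => (1 : ℂ)) b = 0) {N : ℕ} (hN : 1 ≤ N) :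
    eval (fun _ => (1 : ℂ)) ((polyMatrix n a b ^ N) 1 1) +
      eval (fun _ => (1 : ℂ)) ((polyMatrix n a b ^ N) 1 0) = 0 := by
  obtain ⟨N, rfl⟩ := Nat.exists_eq_add_of_le' hN
  have hr : eval (fun _ => (1 : ℂ)) (reflect n a) + eval (fun _ => (1 : ℂ)) (reflect n b) = 0 := by
    rw [eval_reflect_of_mem_torus ha (one_mem_torus m),
      eval_reflect_of_mem_torus hb (one_mem_torus m), ← mul_add, ← map_add, hab, map_zero, mul_zero]
  rw [pow_succ, Matrix.mul_apply, Matrix.mul_apply, Fin.sum_univ_two, Fin.sum_univ_two]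
  simp only [polyMatrix, Matrix.of_apply, Matrix.cons_val_zero, Matrix.cons_val_one,
    Matrix.cons_val', Matrix.cons_val_fin_one, map_add, map_mul]
  generalize eval (fun _ => (1 : ℂ)) ((!![reflect n a, reflect n b; b, a] ^ N) 1 0) = x
  generalize eval (fun _ => (1 : ℂ)) ((!![reflect n a, reflect n b; b, a] ^ N) 1 1) = y
  linear_combination x * hr + y * hab

theorem sliceMatrix_ofSlice (ha : ∀ j, a.degreeOf j ≤ n j) (hb : ∀ j, b.degreeOf j ≤ n j)
    (z : Fin m → ℂ) :
    sliceMatrix n (ofSlice a b) z = (eval z).mapMatrix (polyMatrix n a b) := by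
  have hpd : ∀ u v : MvPolynomial (Fin m) ℂ,
      pderiv (Fin.last m) (ofSlice u v) = rename Fin.castSucc v := fun u v => by
    have h0 : ∀ w : MvPolynomial (Fin m) ℂ,
        pderiv (Fin.last m) (rename Fin.castSucc w) = 0 := fun w =>
      pderiv_eq_zero_of_notMem_vars fun h =>
        mem_vars_iff_degreeOf_ne_zero.1 h (degreeOf_last_rename w)
    simp [ofSlice, h0]
  simp only [sliceMatrix, reflect_ofSlice_eq ha hb, hpd, eval_snoc_ofSlice, eval_rename,
    zero_mul, add_zero]
  have hz : (Fin.snoc z 0 : Fin (m + 1) → ℂ) ∘ Fin.castSucc = z := by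
    funext j
    simp
  ext i j
  fin_cases i <;> fin_cases j <;> simp [polyMatrix, hz]

theorem eval_one_polyMatrix_pow_ne_zero (hm : 0 < m) (ha : ∀ j, a.degreeOf j ≤ n j)
    (hb : ∀ j, b.degreeOf j ≤ n j)
    (hab : eval (fun _ => (1 : ℂ)) a + eval (fun _ => (1 : ℂ)) b = 0) {N : ℕ} (hN : 1 ≤ N)
    (hcop : IsRelPrime (iterNum n a b N) (iterDen n a b N))
    (hnondeg : 3 ≤ m + 1 → sliceMatrix n (ofSlice a b) (fun _ => 1) ^ N ≠ 0) :
    eval (fun _ => (1 : ℂ)) ((polyMatrix n a b ^ N) 1 1) ≠ 0 := by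
  intro h11
  have h10 : eval (fun _ => (1 : ℂ)) ((polyMatrix n a b ^ N) 1 0) = 0 := by
    simpa [h11] using eval_one_polyMatrix_pow_row ha hb hab hN
  obtain ⟨h00, h01⟩ := eval_polyMatrix_pow_of_mem_torus ha hb N (one_mem_torus m)
  rw [h11, map_zero, mul_zero] at h00
  rw [h10, map_zero, mul_zero] at h01
  -- All entries of `M(1)^N` now vanish. For `m = 1`, `z₁ - 1` divides numerator and denominator;
  -- otherwise this contradicts `hnondeg`.
  obtain rfl | hm2 : m = 1 ∨ 3 ≤ m + 1 := by omega
  · have hdvd : ∀ u v : MvPolynomial (Fin 1) ℂ, eval (fun _ => 1) u = 0 → eval (fun _ => 1) v = 0 →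
        (X (Fin.castSucc 0) - C 1 : MvPolynomial (Fin 2) ℂ) ∣ ofSlice u v := by
      have h : ∀ u : MvPolynomial (Fin 1) ℂ, eval (fun _ => 1) u = 0 →
          (X (Fin.castSucc 0) - C 1 : MvPolynomial (Fin 2) ℂ) ∣ rename Fin.castSucc u := by
        intro u hu
        simpa using map_dvd (rename (Fin.castSucc : Fin 1 → Fin 2)) (X_sub_C_dvd hu)
      exact fun u v hu hv => dvd_add (h u hu) ((h v hv).mul_left _)
    exact not_isUnit_X_sub_C _ _ (hcop (hdvd _ _ h01 h00) (hdvd _ _ h11 h10))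
  · refine hnondeg hm2 ?_
    rw [sliceMatrix_ofSlice ha hb, ← map_pow]
    ext i j
    fin_cases i <;> fin_cases j <;> simp [h00, h01, h10, h11]

/-- There is no such polynomial with a zero on the torus in one variable. -/
theorem pos_of_isFiniteSingularity {p : MvPolynomial (Fin (m + 1)) ℂ}
    (hp : IsFiniteSingularity n p) (hsing : eval (fun _ => (1 : ℂ)) p = 0) : 0 < m := by
  refine Nat.pos_of_ne_zero ?_
  rintro rfl
  refine not_isUnit_X_sub_C (0 : Fin 1) 1 (hp.atoral (X_sub_C_dvd hsing) (X_sub_C_dvd ?_))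
  rw [eval_reflect_of_mem_torus (fun j => (hp.degree j).le) (one_mem_torus 1), hsing, map_zero,
    mul_zero]

end RIF

end

/-! ### Assembly of the main theorem -/

theorem mainTheorem1 {m : ℕ} (n : Fin m → ℕ) (p : MvPolynomial (Fin (m + 1)) ℂ)
    (hp : RIF.IsFiniteSingularity n p)
    (hsing : MvPolynomial.eval (fun _ => (1 : ℂ)) p = 0)
    (q : ℝ) (hq : 0 ≤ q)
    (hindex : RIF.IsLocalIndex (RIF.quot (RIF.polydeg n) p) (1 + q))
    (N : ℕ) (hN : 1 ≤ N)
    (hfull : RIF.HasPolydegree (RIF.sliceIter (RIF.quot (RIF.polydeg n) p) N)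
      (RIF.polydeg (fun j => N * n j)))
    (hnondeg : 3 ≤ m + 1 → RIF.sliceMatrix n p (fun _ => 1) ^ N ≠ 0) :
    (∃ pN : MvPolynomial (Fin (m + 1)) ℂ,
      RIF.IsStable pN ∧
      (∀ j, pN.degreeOf j ≤ RIF.polydeg (fun j => N * n j) j) ∧
      IsRelPrime (RIF.reflect (RIF.polydeg (fun j => N * n j)) pN) pN ∧
      (∀ z ∈ RIF.polydisk (m + 1),
        RIF.sliceIter (RIF.quot (RIF.polydeg n) p) N z =
          RIF.quot (RIF.polydeg (fun j => N * n j)) pN z) ∧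
      MvPolynomial.eval (fun _ => (1 : ℂ)) pN = 0) ∧
    RIF.IsLocalIndex (RIF.sliceIter (RIF.quot (RIF.polydeg n) p) N) (1 + q / N) := by
  have hm := RIF.pos_of_isFiniteSingularity hp hsing
  obtain ⟨a, b, ha, hb, rfl⟩ := RIF.exists_eq_ofSlice fun j => (hp.degree j).le
  have hstab := RIF.isStable_iterDen hm ha hb hp.stable hp.finite
  have hab : MvPolynomial.eval (fun _ => (1 : ℂ)) a + MvPolynomial.eval (fun _ => (1 : ℂ)) b = 0 := by
    simpa [RIF.eval_ofSlice] using hsing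
  have hiter : ∀ z ∈ RIF.polydisk (m + 1),
      RIF.sliceIter (RIF.quot (RIF.polydeg n) (RIF.ofSlice a b)) N z =
        MvPolynomial.eval z (RIF.iterNum n a b N) / MvPolynomial.eval z (RIF.iterDen n a b N) :=
    fun z hz => RIF.sliceIter_quot_eq ha hb fun k _ => hstab k z hz
  have hcop := RIF.isRelPrime_of_hasPolydegree hfull (hstab N) hiter
    (RIF.degreeOf_iterNum_le ha hb N) (RIF.degreeOf_iterDen_le ha hb N)
  have hrow := fun N hN => RIF.eval_one_polyMatrix_pow_row (N := N) ha hb hab hN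
  refine ⟨⟨RIF.iterDen n a b N, hstab N, RIF.degreeOf_iterDen_le ha hb N, ?_, ?_, ?_⟩, ?_⟩
  · rwa [RIF.reflect_iterDen ha hb]
  · intro z hz
    rw [hiter z hz, RIF.quot, RIF.reflect_iterDen ha hb]
  · rw [RIF.iterDen, RIF.eval_ofSlice, one_mul]
    exact hrow N hN
  · exact RIF.isLocalIndex_sliceIter hm ha hb hp.stable hp.finite hrow hN
      (RIF.eval_one_polyMatrix_pow_ne_zero hm ha hb hab hN hcop hnondeg) hindex
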